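/- Let $r$ and $d$ be fixed positive integers with $r<d$. A random $d$-ary recursive tree is the following random process $(\mathcal T_t)_{t\ge 0}$ of rooted trees: $\mathcal T_0$ is a single vertex, and for each $t\ge 0$, given the past, $\mathcal T_{t+1}$ is obtained from $\mathcal T_t$ by choosing uniformly at random a vertex with no offspring and connecting it with exactly $d$ (distinguishable) new offspring. An $r$-ary subtree of $\mathcal T_t$ is a subtree (a nonempty connected set of vertices) in which every vertex has at most $r$ offspring; let $S_t$ denote the number of vertices of a largest $r$-ary subtree of $\mathcal T_t$. Let $(B_1,\dots,B_d)$ be a random vector with the Dirichlet$(1/(d-1),\dots,1/(d-1))$ distribution, i.e. carried by the simplex $\{x : x_i\ge 0,\ \sum_i x_i=1\}$ and having there (with respect to Lebesgue measure in the first $d-1$ coordinates) the density $$\frac{\Gamma\big(d/(d-1)\big)}{\Gamma\big(1/(d-1)\big)^d}\prod_{j=1}^d x_j^{1/(d-1)-1},$$ and let $$\Upsilon=\min\{B_{i_1}+\dots+B_{i_{d-r}} : 1\le i_1<\dots<i_{d-r}\le d\}.$$ Let $\tau,\kappa,\lambda$ be positive constants with $\tau>e^{d-1}$ satisfying $$e\,d\,\log\tau<(d-1)\,\tau^{1/(d-1)}\qquad\text{and}\qquad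 d\,\kappa^{\lambda}\,\mathbf E\big[(1-\Upsilon)^{\lambda}\big]<1,$$ and let $n=\lfloor \log t/\log\tau\rfloor$. Then there exists a constant $K$ (depending only on $r,d,\tau,\kappa,\lambda$) such that, almost surely, for all sufficiently large $t$, $$S_t\le K\left(r^{n}+t\,\kappa^{-n}\right).$$ -/

import Mathlib

open MeasureTheory Filter

noncomputable section

/-! ### The random `d`-ary recursive tree

The vertices of the infinite rooted `d`-ary tree are the lists over `Fin d`: the root is `[]`, and
the offspring of `v` are the vertices `i :: v`, `i : Fin d`. Hence `w` lies on the path from the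
root to `v` exactly when `w` is a suffix of `v`, written `w <:+ v`. -/

/-- The leaves (vertices with no offspring) of a finite set of vertices `V`. -/
def treeLeaves {d : ℕ} (V : Finset (List (Fin d))) : Finset (List (Fin d)) :=
  V.filter fun v => ∀ i : Fin d, i :: v ∉ V

/-- The tree obtained from `V` when the vertex `v` gives birth to `d` offspring. -/
def treeGrow {d : ℕ} (V : Finset (List (Fin d))) (v : List (Fin d)) : Finset (List (Fin d)) :=
  V ∪ Finset.univ.image fun i : Fin d => i :: v

/-- `T 0, T 1, T 2, …` (each given by its vertex set) is a random `d`-ary recursive tree process: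
at time `0` the tree is the single vertex `[]`, and, conditionally on the whole past up to time
`t`, the tree at time `t + 1` arises from the tree at time `t` by letting a uniformly random leaf
give birth to `d` offspring. Distinct leaves give distinct trees at time `t + 1`. -/
structure IsRandomRecursiveTree (d : ℕ) {Ω : Type*} [MeasurableSpace Ω] (P : Measure Ω)
    (T : ℕ → Ω → Finset (List (Fin d))) : Prop where
  measurable : ∀ (t : ℕ) (V : Finset (List (Fin d))), MeasurableSet {ω | T t ω = V}
  init : ∀ᵐ ω ∂P, T 0 ω = {[]}
  step : ∀ (t : ℕ) (h : ℕ → Finset (List (Fin d))), ∀ v ∈ treeLeaves (h t),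
    P {ω | (∀ s ≤ t, T s ω = h s) ∧ T (t + 1) ω = treeGrow (h t) v} =
      P {ω | ∀ s ≤ t, T s ω = h s} / ((treeLeaves (h t)).card : ENNReal)

/-- `A` is the vertex set of an `r`-ary subtree: it has a topmost vertex `ρ`, with each vertex it
contains the whole path down from `ρ` to that vertex, and each of its vertices has at most `r`
offspring in it. -/
def IsArySubtree {d : ℕ} (r : ℕ) (A : Finset (List (Fin d))) : Prop :=
  (∃ ρ ∈ A, ∀ v ∈ A, ρ <:+ v ∧ ∀ w : List (Fin d), ρ <:+ w → w <:+ v → w ∈ A) ∧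
    ∀ v ∈ A, (Finset.univ.filter fun i : Fin d => i :: v ∈ A).card ≤ r

open Classical in
/-- The number of vertices of a largest `r`-ary subtree of the tree with vertex set `V`. -/
def largestArySubtree {d : ℕ} (r : ℕ) (V : Finset (List (Fin d))) : ℕ :=
  (V.powerset.filter fun A => IsArySubtree r A).sup Finset.card

/-! ### The Dirichlet distribution -/

/-- The point of the hyperplane `∑ i, y i = 1` in `ℝ ^ n` with the given first `n - 1`
coordinates. -/
def simplexPoint {n : ℕ} (x : Fin (n - 1) → ℝ) : Fin n → ℝ :=
  fun i => if h : (i : ℕ) < n - 1 then x ⟨i, h⟩ else 1 - ∑ j, x j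

theorem measurable_simplexPoint {n : ℕ} : Measurable (simplexPoint (n := n)) := by
  refine measurable_pi_lambda _ fun i => ?_
  unfold simplexPoint
  split_ifs <;> fun_prop

open Classical in
/-- The density of the Dirichlet distribution with parameters `α`, at the point `y` of the
hyperplane `∑ i, y i = 1`, with respect to Lebesgue measure in the first `n - 1` coordinates. -/
def dirichletDensity {n : ℕ} (α : Fin n → ℝ) (y : Fin n → ℝ) : ℝ :=
  if ∀ i, 0 < y i then
    Real.Gamma (∑ i, α i) / (∏ i, Real.Gamma (α i)) * ∏ i, y i ^ (α i - 1)
  else 0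

/-- The Dirichlet distribution with positive parameters `α 0, …, α (n - 1)`, `n ≥ 1`, as a measure
on `ℝ ^ n` carried by the standard simplex. -/
def dirichletMeasure {n : ℕ} (α : Fin n → ℝ) : Measure (Fin n → ℝ) :=
  ((volume : Measure (Fin (n - 1) → ℝ)).withDensity fun x =>
    ENNReal.ofReal (dirichletDensity α (simplexPoint x))).map simplexPoint

/-- The smallest sum of `d - r` of the coordinates of `x`. -/
def minCoordSum {d : ℕ} (r : ℕ) (x : Fin d → ℝ) : ℝ :=
  ((Finset.univ : Finset (Fin d)).powersetCard (d - r)).inf'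
    (Finset.powersetCard_nonempty.2 (by simp)) fun s => ∑ i ∈ s, x i

end

/-! An `r`-ary subtree enters at most `r` of the `d` subtrees at the offspring of the root, and
these hold at most the fraction `rootShare` of the inner vertices below the root. Iterating this
over `n` generations (`IsFullTree.largest_le`) bounds its size by `smallBound`, of order `r ^ n`
(linear in `n` if `r = 1`), plus the size of the tree times the largest product of shares along a
path of length `n`. That maximum is dominated by the `1 / p`-th power of `pathSum`, a sum of `p`-th
powers, with `p = lam` in the end. Subtrees with fewer than `N` inner vertices have bounded size, so
paths through them can be dropped from the sum.

The mean of the path sum decays geometrically. The numbers of inner vertices in the `d` subtrees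
form a Pólya urn with initial weights `1 / (d - 1)`, and given these numbers each subtree is again a
random recursive tree (`iterate_leafAvg_childCounts_mul`). The urn is a Dirichlet mixture of
independent draws (`polyaMean_eq_integral`), so for large trees the moment of the root share is
below any `b > E[(1 - Υ) ^ lam]` (`exists_polyaMean_rootShare_le`). Hence the mean path sum is at
most `(d * b) ^ n` (`iterate_leafAvg_pathSum_le`), where `b` can be chosen with `d * κ ^ lam * b <
1`.

Markov's inequality and Borel–Cantelli at the times `⌈τ ^ (n + 1)⌉` then make the path sum smaller
than `κ ^ (-lam * n)` for all large `n`, almost surely. Monotonicity of the tree in time covers the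
times in between. -/

/-! ### Full trees and the subtrees at the offspring of the root -/

/-- `V` contains the root and is closed under passing to the parent and to siblings. -/
structure IsFullTree {d : ℕ} (V : Finset (List (Fin d))) : Prop where
  nil_mem : [] ∈ V
  parent_mem : ∀ i v, i :: v ∈ V → v ∈ V
  sibling_mem : ∀ i j v, i :: v ∈ V → j :: v ∈ V

/-- The number of vertices of `V` that have offspring. -/
def innerCount {d : ℕ} (V : Finset (List (Fin d))) : ℕ := (V \ treeLeaves V).card

/-- The part of `V` below the offspring `[i]` of the root, moved to the root. -/
noncomputable def subtreeAt {d : ℕ} (i : Fin d) (V : Finset (List (Fin d))) :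
    Finset (List (Fin d)) :=
  V.preimage (fun u => u ++ [i]) (List.append_left_injective [i]).injOn

/-- The numbers of inner vertices of the subtrees at the offspring of the root. -/
noncomputable def childCounts {d : ℕ} (V : Finset (List (Fin d))) : Fin d → ℕ :=
  fun i => innerCount (subtreeAt i V)

section

variable {d : ℕ} {V : Finset (List (Fin d))} {v u : List (Fin d)} {i j : Fin d}

@[simp] theorem mem_subtreeAt : u ∈ subtreeAt i V ↔ u ++ [i] ∈ V := by
  simp [subtreeAt]

theorem mem_treeLeaves : v ∈ treeLeaves V ↔ v ∈ V ∧ ∀ i : Fin d, i :: v ∉ V := by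
  simp [treeLeaves]

theorem mem_treeGrow : u ∈ treeGrow V v ↔ u ∈ V ∨ ∃ i : Fin d, i :: v = u := by
  simp [treeGrow]

theorem isFullTree_singleton : IsFullTree ({[]} : Finset (List (Fin d))) :=
  ⟨by simp, by simp, by simp⟩

theorem IsFullTree.grow (hV : IsFullTree V) (hv : v ∈ V) : IsFullTree (treeGrow V v) := by
  refine ⟨mem_treeGrow.2 (.inl hV.nil_mem), fun i w hw => ?_, fun i j w hw => ?_⟩
  · rcases mem_treeGrow.1 hw with h | ⟨j, h⟩
    · exact mem_treeGrow.2 (.inl (hV.parent_mem _ _ h))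
    · obtain ⟨rfl, rfl⟩ := List.cons.inj h
      exact mem_treeGrow.2 (.inl hv)
  · rcases mem_treeGrow.1 hw with h | ⟨k, h⟩
    · exact mem_treeGrow.2 (.inl (hV.sibling_mem _ _ _ h))
    · obtain ⟨rfl, rfl⟩ := List.cons.inj h
      exact mem_treeGrow.2 (.inr ⟨j, rfl⟩)

theorem IsFullTree.mem_of_append (hV : IsFullTree V) : ∀ w : List (Fin d), w ++ v ∈ V → v ∈ V
  | [], h => h
  | _ :: w, h => hV.mem_of_append w (hV.parent_mem _ _ h)

theorem IsFullTree.subtree (hV : IsFullTree V) (h : ∀ i : Fin d, [i] ∈ V) (i : Fin d) :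
    IsFullTree (subtreeAt i V) := by
  refine ⟨by simpa using h i, fun j v hv => ?_, fun j k v hv => ?_⟩
  · rw [mem_subtreeAt] at hv ⊢
    exact hV.parent_mem _ _ hv
  · rw [mem_subtreeAt] at hv ⊢
    exact hV.sibling_mem _ _ _ hv

theorem IsFullTree.singleton_mem (hV : IsFullTree V) (h : 0 < innerCount V) (i : Fin d) :
    [i] ∈ V := by
  obtain ⟨v, hv⟩ := Finset.card_pos.1 h
  rw [Finset.mem_sdiff, mem_treeLeaves] at hv
  push Not at hv
  obtain ⟨j, hj⟩ := hv.2 hv.1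
  -- The last entry `k` names the offspring of the root through which the path passes.
  obtain ⟨w, k, hw⟩ : ∃ w k, j :: v = w ++ [k] := by
    have := List.dropLast_append_getLast (List.cons_ne_nil j v)
    exact ⟨_, _, this.symm⟩
  rw [hw] at hj
  exact hV.sibling_mem _ _ _ (hV.mem_of_append w hj)

/-- Each vertex other than the root is one of the `d` offspring of exactly one inner vertex. -/
theorem IsFullTree.card_eq (hV : IsFullTree V) : V.card = d * innerCount V + 1 := by
  have h : V.erase [] = ((V \ treeLeaves V) ×ˢ (Finset.univ : Finset (Fin d))).map
      ⟨fun p => p.2 :: p.1, fun p q h => by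
        obtain ⟨h1, h2⟩ := List.cons.inj h
        exact Prod.ext h2 h1⟩ := by
    ext w
    simp only [Finset.mem_erase, Finset.mem_map, Finset.mem_product, Finset.mem_sdiff,
      mem_treeLeaves, Finset.mem_univ, and_true, Prod.exists]
    constructor
    · rintro ⟨h0, hw⟩
      cases w with
      | nil => exact absurd rfl h0
      | cons i v =>
        exact ⟨v, i, ⟨hV.parent_mem _ _ hw, fun h => h.2 i hw⟩, rfl⟩
    · rintro ⟨v, i, ⟨hv, hn⟩, rfl⟩
      push Not at hn
      obtain ⟨j, hj⟩ := hn hv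
      exact ⟨List.cons_ne_nil _ _, hV.sibling_mem _ _ _ hj⟩
  have h2 := Finset.card_erase_add_one hV.nil_mem
  rw [h, Finset.card_map, Finset.card_product, Finset.card_univ, Fintype.card_fin] at h2
  rw [← h2, mul_comm]
  rfl

theorem treeLeaves_subset : treeLeaves V ⊆ V := Finset.filter_subset _ _

theorem IsFullTree.card_treeLeaves_add (hV : IsFullTree V) :
    (treeLeaves V).card + innerCount V = d * innerCount V + 1 := by
  rw [← hV.card_eq, innerCount, add_comm, Finset.card_sdiff_add_card_eq_card treeLeaves_subset]

theorem IsFullTree.card_treeLeaves (hV : IsFullTree V) :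
    ((treeLeaves V).card : ℝ) = ((d : ℝ) - 1) * innerCount V + 1 := by
  have := congrArg (Nat.cast : ℕ → ℝ) hV.card_treeLeaves_add
  push_cast at this
  linarith

theorem treeLeaves_singleton : treeLeaves ({[]} : Finset (List (Fin d))) = {[]} := by
  ext v
  simp only [mem_treeLeaves, Finset.mem_singleton, List.cons_ne_nil, not_false_eq_true,
    implies_true, and_true]

theorem innerCount_singleton : innerCount ({[]} : Finset (List (Fin d))) = 0 := by
  rw [innerCount, treeLeaves_singleton]
  simp

theorem IsFullTree.innerCount_grow (hV : IsFullTree V) (hd : 0 < d) (hv : v ∈ treeLeaves V) :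
    innerCount (treeGrow V v) = innerCount V + 1 := by
  have hv' := mem_treeLeaves.1 hv
  have h : treeGrow V v \ treeLeaves (treeGrow V v) = insert v (V \ treeLeaves V) := by
    ext w
    simp only [Finset.mem_sdiff, mem_treeLeaves, mem_treeGrow, Finset.mem_insert]
    constructor
    · rintro ⟨hw, hn⟩
      push Not at hn
      obtain ⟨i, h | ⟨j, h⟩⟩ := hn hw
      · right
        have hwV : w ∈ V := hV.parent_mem _ _ h
        exact ⟨hwV, fun h' => h'.2 i h⟩
      · exact .inl (List.cons.inj h).2.symm
    · rintro (rfl | ⟨hw, hn⟩)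
      · exact ⟨.inl hv'.1, fun h => h.2 ⟨0, hd⟩ (.inr ⟨_, rfl⟩)⟩
      · refine ⟨.inl hw, fun h => hn ⟨hw, fun i hi => h.2 i (.inl hi)⟩⟩
  rw [innerCount, h, Finset.card_insert_of_notMem (by simp [hv]), innerCount]

theorem IsFullTree.treeLeaves_nonempty (hV : IsFullTree V) (hd : 0 < d) :
    (treeLeaves V).Nonempty := by
  have h := hV.card_treeLeaves_add
  have h2 : innerCount V ≤ d * innerCount V := Nat.le_mul_of_pos_left _ hd
  exact Finset.card_pos.1 (by lia)

/-- This makes the events that different leaves give birth disjoint. -/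
theorem treeGrow_injOn (hd : 0 < d) :
    Set.InjOn (treeGrow V) (treeLeaves V : Set (List (Fin d))) := by
  intro v hv w hw h
  have h1 : (⟨0, hd⟩ : Fin d) :: v ∈ treeGrow V w := h ▸ mem_treeGrow.2 (.inr ⟨_, rfl⟩)
  rcases mem_treeGrow.1 h1 with h2 | ⟨j, h2⟩
  · exact absurd h2 ((mem_treeLeaves.1 hv).2 _)
  · exact (List.cons.inj h2).2.symm

theorem subset_treeGrow : V ⊆ treeGrow V v := Finset.subset_union_left

theorem mem_treeLeaves_subtreeAt :
    u ∈ treeLeaves (subtreeAt i V) ↔ u ++ [i] ∈ treeLeaves V := by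
  simp [mem_treeLeaves]

theorem sum_treeLeaves (h : ∀ i : Fin d, [i] ∈ V) (hd : 0 < d) (f : List (Fin d) → ℝ) :
    ∑ v ∈ treeLeaves V, f v = ∑ i, ∑ u ∈ treeLeaves (subtreeAt i V), f (u ++ [i]) := by
  have hbU : treeLeaves V = Finset.univ.biUnion fun i : Fin d =>
      (treeLeaves (subtreeAt i V)).image fun u => u ++ [i] := by
    ext w
    simp only [Finset.mem_biUnion, Finset.mem_univ, true_and, Finset.mem_image]
    constructor
    · intro hw
      rcases List.eq_nil_or_concat w with rfl | ⟨u, i, rfl⟩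
      · exact absurd (h ⟨0, hd⟩) ((mem_treeLeaves.1 hw).2 _)
      · simp only [List.concat_eq_append] at hw ⊢
        exact ⟨i, u, mem_treeLeaves_subtreeAt.2 hw, rfl⟩
    · rintro ⟨i, u, hu, rfl⟩
      exact mem_treeLeaves_subtreeAt.1 hu
  rw [hbU, Finset.sum_biUnion]
  · refine Finset.sum_congr rfl fun i _ => Finset.sum_image fun x _ y _ hxy => ?_
    exact List.append_left_injective _ hxy
  · intro i _ j _ hij
    refine Finset.disjoint_left.2 fun w hw hw' => hij ?_
    obtain ⟨u, -, rfl⟩ := Finset.mem_image.1 hw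
    obtain ⟨u', -, h'⟩ := Finset.mem_image.1 hw'
    simpa using (List.append_inj' h' rfl).2.symm

theorem subtreeAt_grow_same : subtreeAt i (treeGrow V (u ++ [i])) = treeGrow (subtreeAt i V) u := by
  ext w
  simp only [mem_subtreeAt, mem_treeGrow, ← List.cons_append, List.append_left_inj]

theorem subtreeAt_grow_ne (hij : j ≠ i) :
    subtreeAt j (treeGrow V (u ++ [i])) = subtreeAt j V := by
  ext w
  simp only [mem_subtreeAt, mem_treeGrow, ← List.cons_append, or_iff_left_iff_imp]
  rintro ⟨k, hk⟩
  exact absurd (List.append_inj' hk rfl).2 (by simpa using hij.symm)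

theorem IsFullTree.childCounts_grow (hV : IsFullTree V) (h : ∀ i : Fin d, [i] ∈ V) (hd : 0 < d)
    (hu : u ∈ treeLeaves (subtreeAt i V)) :
    childCounts (treeGrow V (u ++ [i])) = childCounts V + Pi.single i 1 := by
  ext j
  by_cases hij : j = i
  · subst hij
    simp [childCounts, subtreeAt_grow_same, (hV.subtree h j).innerCount_grow hd hu]
  · simp [childCounts, subtreeAt_grow_ne hij, Pi.single_eq_of_ne hij]

/-- The leaves of the tree are those of the `d` subtrees. Expressing both counts through inner
vertices and cancelling `d - 1` gives the identity. -/
theorem IsFullTree.innerCount_eq (hV : IsFullTree V) (h : ∀ i : Fin d, [i] ∈ V) (hd : 1 < d) :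
    innerCount V = 1 + ∑ i, childCounts V i := by
  have hl : ∀ W : Finset (List (Fin d)), ((treeLeaves W).card : ℝ) = ∑ v ∈ treeLeaves W, 1 := by
    simp
  have h1 := hV.card_treeLeaves
  rw [hl, sum_treeLeaves h (by lia)] at h1
  simp only [← hl, fun i => (hV.subtree h i).card_treeLeaves] at h1
  rw [Finset.sum_add_distrib, ← Finset.mul_sum] at h1
  simp only [Finset.sum_const, Finset.card_univ, Fintype.card_fin, nsmul_eq_mul, mul_one] at h1
  have h3 : (0 : ℝ) < (d : ℝ) - 1 := by
    have : (1 : ℝ) < d := by exact_mod_cast hd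
    linarith
  have h4 : ((d : ℝ) - 1) * innerCount V = ((d : ℝ) - 1) * (1 + ∑ i, (childCounts V i : ℝ)) := by
    unfold childCounts
    linarith
  exact_mod_cast mul_left_cancel₀ h3.ne' h4

end

/-! ### A deterministic bound for the largest `r`-ary subtree -/

/-- The largest share of the total weight `∑ i, x i = 1` that is carried by `r` of the coordinates. -/
noncomputable def maxShare {d : ℕ} (r : ℕ) (x : Fin d → ℝ) : ℝ := 1 - minCoordSum r x

/-- The largest share of the inner vertices below the root that lie in `r` of the subtrees at the
offspring of the root. -/
noncomputable def rootShare {d : ℕ} (r : ℕ) (m : Fin d → ℕ) : ℝ :=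
  maxShare r fun i => (m i : ℝ) / ((∑ j, m j : ℕ) : ℝ)

/-- The sum of the `p`-th powers of the products of the root shares along a path, over all paths of
length `n` from the root such that the subtree rooted at each vertex but the last has at least `N`
inner vertices. -/
noncomputable def pathSum {d : ℕ} (r N : ℕ) (p : ℝ) : ℕ → Finset (List (Fin d)) → ℝ
  | 0, _ => 1
  | n + 1, V => if innerCount V < N then 0 else
      rootShare r (childCounts V) ^ p * ∑ i, pathSum r N p n (subtreeAt i V)

section

variable {d r : ℕ} {V : Finset (List (Fin d))}

theorem minCoordSum_le {x : Fin d → ℝ} {s : Finset (Fin d)} (hs : s.card = d - r) :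
    minCoordSum r x ≤ ∑ i ∈ s, x i :=
  Finset.inf'_le _ (Finset.mem_powersetCard.2 ⟨Finset.subset_univ _, hs⟩)

theorem exists_minCoordSum_eq (x : Fin d → ℝ) :
    ∃ s : Finset (Fin d), s.card = d - r ∧ minCoordSum r x = ∑ i ∈ s, x i := by
  obtain ⟨s, hs, h⟩ := Finset.exists_mem_eq_inf'
    (s := (Finset.univ : Finset (Fin d)).powersetCard (d - r))
    (Finset.powersetCard_nonempty.2 (by simp)) fun s => ∑ i ∈ s, x i
  exact ⟨s, (Finset.mem_powersetCard.1 hs).2, h⟩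

/-- The complement of `I` contains `d - r` coordinates, whose sum is at least the minimal one. -/
theorem sum_le_maxShare {x : Fin d → ℝ} (hx : ∀ i, 0 ≤ x i) (h1 : ∑ i, x i = 1)
    {I : Finset (Fin d)} (hI : I.card ≤ r) : ∑ i ∈ I, x i ≤ maxShare r x := by
  have hc : d - r ≤ Iᶜ.card := by
    rw [Finset.card_compl, Fintype.card_fin]
    lia
  obtain ⟨s, hs, hcard⟩ := Finset.exists_subset_card_eq hc
  have h2 := minCoordSum_le (x := x) hcard
  have h3 : ∑ i ∈ s, x i ≤ ∑ i ∈ Iᶜ, x i := Finset.sum_le_sum_of_subset_of_nonneg hs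
    fun i _ _ => hx i
  have h4 := Finset.sum_add_sum_compl I x
  unfold maxShare
  linarith

theorem maxShare_le_one {x : Fin d → ℝ} (hx : ∀ i, 0 ≤ x i) : maxShare r x ≤ 1 := by
  obtain ⟨s, -, hs⟩ := exists_minCoordSum_eq (r := r) x
  have := Finset.sum_nonneg (s := s) fun i _ => hx i
  unfold maxShare
  linarith

theorem maxShare_nonneg {x : Fin d → ℝ} (hx : ∀ i, 0 ≤ x i) (h1 : ∑ i, x i = 1) :
    0 ≤ maxShare r x := by
  simpa using sum_le_maxShare (r := r) hx h1 (I := ∅) (by simp)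

theorem maxShare_sub_le (x y : Fin d → ℝ) : maxShare r x - maxShare r y ≤ ∑ i, |x i - y i| := by
  obtain ⟨s, hs, h⟩ := exists_minCoordSum_eq (r := r) x
  have h2 := minCoordSum_le (x := y) hs
  have h3 : ∑ i ∈ s, y i - ∑ i ∈ s, x i ≤ ∑ i ∈ s, |x i - y i| := by
    rw [← Finset.sum_sub_distrib]
    exact Finset.sum_le_sum fun i _ => by rw [abs_sub_comm]; exact le_abs_self _
  have h4 : ∑ i ∈ s, |x i - y i| ≤ ∑ i, |x i - y i| :=
    Finset.sum_le_sum_of_subset_of_nonneg (Finset.subset_univ _) fun i _ _ => abs_nonneg _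
  unfold maxShare
  linarith

theorem rootShare_nonneg_of_pos (m : Fin d → ℕ) (h : 0 < ∑ j, m j) : 0 ≤ rootShare r m := by
  refine maxShare_nonneg (fun i => by positivity) ?_
  rw [← Finset.sum_div, Nat.cast_sum, div_self]
  exact_mod_cast h.ne'

theorem rootShare_nonneg (m : Fin d → ℕ) : 0 ≤ rootShare r m := by
  rcases (∑ j, m j).eq_zero_or_pos with h | h
  -- Division by zero makes all quotients `0` here, so the share is `1`.
  · obtain ⟨s, -, hs⟩ := exists_minCoordSum_eq (r := r) fun i => (m i : ℝ) / ((∑ j, m j : ℕ) : ℝ)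
    rw [rootShare, maxShare, hs]
    simp [h]
  · exact rootShare_nonneg_of_pos m h

theorem sum_le_rootShare (m : Fin d → ℕ) {I : Finset (Fin d)} (hI : I.card ≤ r) :
    ∑ i ∈ I, (m i : ℝ) ≤ rootShare r m * ((∑ j, m j : ℕ) : ℝ) := by
  rcases (∑ j, m j).eq_zero_or_pos with h | h
  · have h0 := Finset.sum_eq_zero_iff.1 h
    rw [h]
    simp [h0]
  · have h1 : (0 : ℝ) < ((∑ j, m j : ℕ) : ℝ) := by exact_mod_cast h
    rw [← div_le_iff₀ h1, Finset.sum_div]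
    refine sum_le_maxShare (fun i => by positivity) ?_ hI
    rw [← Finset.sum_div, Nat.cast_sum, div_self]
    exact_mod_cast h.ne'

theorem pathSum_nonneg (N : ℕ) (p : ℝ) : ∀ (n : ℕ) (V : Finset (List (Fin d))),
    0 ≤ pathSum r N p n V
  | 0, _ => zero_le_one
  | n + 1, V => by
    rw [pathSum]
    split_ifs
    · exact le_rfl
    · exact mul_nonneg (Real.rpow_nonneg (rootShare_nonneg _) _)
        (Finset.sum_nonneg fun i _ => pathSum_nonneg N p n _)

theorem card_le_largestArySubtree {A : Finset (List (Fin d))} (h : A ⊆ V) (hA : IsArySubtree r A) :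
    A.card ≤ largestArySubtree r V := by
  classical
  exact Finset.le_sup (f := Finset.card)
    (Finset.mem_filter.2 ⟨Finset.mem_powerset.2 h, hA⟩)

theorem largestArySubtree_le {b : ℕ} (h : ∀ A ⊆ V, IsArySubtree r A → A.card ≤ b) :
    largestArySubtree r V ≤ b := by
  classical
  refine Finset.sup_le fun A hA => ?_
  rw [Finset.mem_filter, Finset.mem_powerset] at hA
  exact h A hA.1 hA.2

theorem largestArySubtree_mono {W : Finset (List (Fin d))} (h : V ⊆ W) :
    largestArySubtree r V ≤ largestArySubtree r W :=
  largestArySubtree_le fun _ hA h' => card_le_largestArySubtree (hA.trans h) h'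

theorem largestArySubtree_le_card : largestArySubtree r V ≤ V.card :=
  largestArySubtree_le fun _ hA _ => Finset.card_le_card hA

theorem subtreeAt_mono {A : Finset (List (Fin d))} (h : A ⊆ V) (i : Fin d) :
    subtreeAt i A ⊆ subtreeAt i V := fun _ hu => mem_subtreeAt.2 (h (mem_subtreeAt.1 hu))

/-- The part of an `r`-ary subtree below an offspring of the root is `r`-ary if it has a topmost
vertex. -/
theorem IsArySubtree.subtreeAt_of_mem {A : Finset (List (Fin d))} {σ : List (Fin d)} {i : Fin d}
    (hA : IsArySubtree r A) (hσ : σ ++ [i] ∈ A)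
    (h : ∀ u, u ++ [i] ∈ A → σ <:+ u) : IsArySubtree r (subtreeAt i A) := by
  obtain ⟨⟨ρ, hρ, hp⟩, hdeg⟩ := hA
  refine ⟨⟨σ, mem_subtreeAt.2 hσ, fun u hu => ?_⟩, fun u hu => ?_⟩
  · rw [mem_subtreeAt] at hu
    refine ⟨h u hu, fun w hw hwu => mem_subtreeAt.2 ?_⟩
    refine (hp _ hu).2 _ (((hp _ hσ).1).trans ?_) ?_
    · obtain ⟨t, rfl⟩ := hw
      exact ⟨t, by simp⟩
    · obtain ⟨t, rfl⟩ := hwu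
      exact ⟨t, by simp⟩
  · rw [mem_subtreeAt] at hu
    simpa using hdeg _ hu

/-- A subtree containing the root splits into at most `r` pieces besides the root. One whose topmost
vertex is lower lies inside a single subtree, and `0 < r` allows `I` to be a singleton. -/
theorem exists_largestArySubtree_le (hr : 0 < r) :
    ∃ I : Finset (Fin d), I.card ≤ r ∧
      largestArySubtree r V ≤ 1 + ∑ i ∈ I, largestArySubtree r (subtreeAt i V) := by
  classical
  suffices H : ∀ A ⊆ V, IsArySubtree r A → ∃ I : Finset (Fin d), I.card ≤ r ∧
      A.card ≤ 1 + ∑ i ∈ I, largestArySubtree r (subtreeAt i V) by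
    by_cases hne : (V.powerset.filter fun A => IsArySubtree r A).Nonempty
    · obtain ⟨A, hA, hmax⟩ := Finset.exists_mem_eq_sup _ hne Finset.card
      rw [Finset.mem_filter, Finset.mem_powerset] at hA
      obtain ⟨I, hI, h⟩ := H A hA.1 hA.2
      exact ⟨I, hI, by rw [largestArySubtree, hmax]; exact h⟩
    · rw [Finset.not_nonempty_iff_eq_empty] at hne
      exact ⟨∅, by simp, by simp [largestArySubtree, hne]⟩
  intro A hAV hA
  have hA' := hA
  obtain ⟨⟨ρ, hρ, hp⟩, hdeg⟩ := hA'
  rcases List.eq_nil_or_concat ρ with rfl | ⟨σ, i, rfl⟩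
  · refine ⟨Finset.univ.filter fun i : Fin d => [i] ∈ A, hdeg _ hρ, ?_⟩
    have hsub : A ⊆ insert [] ((Finset.univ.filter fun i : Fin d => [i] ∈ A).biUnion fun i =>
        (subtreeAt i A).image fun u => u ++ [i]) := by
      intro v hv
      rcases List.eq_nil_or_concat v with rfl | ⟨u, i, rfl⟩
      · exact Finset.mem_insert_self _ _
      · rw [List.concat_eq_append] at hv ⊢
        refine Finset.mem_insert_of_mem (Finset.mem_biUnion.2 ⟨i, ?_, ?_⟩)
        · exact Finset.mem_filter.2 ⟨Finset.mem_univ _,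
            (hp _ hv).2 _ List.nil_suffix (List.suffix_append _ _)⟩
        · exact Finset.mem_image.2 ⟨u, mem_subtreeAt.2 hv, rfl⟩
    refine (Finset.card_le_card hsub).trans ((Finset.card_insert_le _ _).trans ?_)
    rw [add_comm]
    refine Nat.add_le_add_left (Finset.card_biUnion_le.trans (Finset.sum_le_sum fun i hi => ?_)) 1
    refine Finset.card_image_le.trans (card_le_largestArySubtree (subtreeAt_mono hAV i) ?_)
    exact hA.subtreeAt_of_mem (σ := []) (by simpa using (Finset.mem_filter.1 hi).2)
      fun u _ => List.nil_suffix
  · rw [List.concat_eq_append] at hρ hp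
    have h0 : ∀ v ∈ A, ∃ u, v = u ++ [i] ∧ σ <:+ u := by
      intro v hv
      obtain ⟨t, rfl⟩ := (hp v hv).1
      exact ⟨t ++ σ, by simp, List.suffix_append _ _⟩
    refine ⟨{i}, by simpa using Nat.succ_le_of_lt hr, ?_⟩
    have hsub : A ⊆ (subtreeAt i A).image fun u => u ++ [i] := by
      intro v hv
      obtain ⟨u, rfl, -⟩ := h0 v hv
      exact Finset.mem_image.2 ⟨u, mem_subtreeAt.2 hv, rfl⟩
    have h1 : A.card ≤ largestArySubtree r (subtreeAt i V) := by
      refine (Finset.card_le_card hsub).trans (Finset.card_image_le.trans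
        (card_le_largestArySubtree (subtreeAt_mono hAV i) ?_))
      refine hA.subtreeAt_of_mem hρ fun u hu => ?_
      obtain ⟨u', h, hs⟩ := h0 _ hu
      rwa [(List.append_inj' h rfl).1]
    rw [Finset.sum_singleton]
    lia

/-- The constant in the bound for the largest `r`-ary subtree that comes from the vertices with few
descendants and from the first `n` generations. -/
def smallBound (r D : ℕ) : ℕ → ℕ
  | 0 => D
  | n + 1 => 1 + r * smallBound r D n

theorem le_smallBound (hr : 0 < r) (D : ℕ) : ∀ n, D ≤ smallBound r D n
  | 0 => le_rfl
  | n + 1 => by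
    have h := le_smallBound hr D n
    have h2 : smallBound r D n ≤ r * smallBound r D n := Nat.le_mul_of_pos_left _ hr
    rw [smallBound]
    lia

theorem smallBound_one (D : ℕ) : ∀ n, smallBound 1 D n = n + D
  | 0 => by simp [smallBound]
  | n + 1 => by
    rw [smallBound, smallBound_one D n]
    lia

/-- Adding `1` turns the affine recursion into a geometric inequality, because `2 ≤ r`. -/
theorem smallBound_add_one_le (hr : 1 < r) (D : ℕ) : ∀ n,
    smallBound r D n + 1 ≤ (D + 1) * r ^ n
  | 0 => by simp [smallBound]
  | n + 1 => by
    have h := Nat.mul_le_mul_left r (smallBound_add_one_le hr D n)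
    rw [smallBound, pow_succ]
    nlinarith

/-- Induction on the number of generations. Trees with fewer than `N` inner vertices have at most
`D` vertices; larger ones have at most `d + 1` times as many vertices as inner vertices, since `0 <
N`. -/
theorem IsFullTree.largest_le (hr : 0 < r) (hd : 1 < d) {N D : ℕ} {p : ℝ} (hp : 0 < p)
    (hN : 0 < N) (hD : d * N + 1 ≤ D) (n : ℕ) : ∀ {V : Finset (List (Fin d))}, IsFullTree V →
    (largestArySubtree r V : ℝ) ≤
      smallBound r D n + (d + 1) * innerCount V * pathSum r N p n V ^ (1 / p) := by
  have hsmall : ∀ n, ∀ {V : Finset (List (Fin d))}, IsFullTree V → innerCount V < N →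
      (largestArySubtree r V : ℝ) ≤
        smallBound r D n + (d + 1) * innerCount V * pathSum r N p n V ^ (1 / p) := by
    intro n V hV h
    have h1 : largestArySubtree r V ≤ smallBound r D n := by
      refine largestArySubtree_le_card.trans (le_trans ?_ (le_smallBound hr D n))
      rw [hV.card_eq]
      exact le_trans (by gcongr) hD
    have h2 : 0 ≤ (d + 1) * innerCount V * pathSum r N p n V ^ (1 / p) := by
      have := Real.rpow_nonneg (pathSum_nonneg (r := r) N p n V) (1 / p)
      positivity
    have h3 : (largestArySubtree r V : ℝ) ≤ smallBound r D n := by exact_mod_cast h1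
    linarith
  induction n with
  | zero =>
    intro V hV
    rcases lt_or_ge (innerCount V) N with h | h
    · exact hsmall 0 hV h
    · have h1 : largestArySubtree r V ≤ (d + 1) * innerCount V := by
        refine largestArySubtree_le_card.trans ?_
        rw [hV.card_eq]
        lia
      have h3 : (largestArySubtree r V : ℝ) ≤ (d + 1) * innerCount V := by exact_mod_cast h1
      simp only [pathSum, Real.one_rpow, mul_one]
      have : (0 : ℝ) ≤ smallBound r D 0 := by positivity
      linarith
  | succ n ih =>
    intro V hV
    rcases lt_or_ge (innerCount V) N with h | h
    · exact hsmall (n + 1) hV h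
    have hroot := hV.singleton_mem (hN.trans_le h)
    obtain ⟨I, hI, hle⟩ := exists_largestArySubtree_le (V := V) hr
    -- `Q` bounds the factors of all offspring at once. Only the counts then depend on the chosen
    -- offspring, and their sum is controlled by the root share.
    set Q : ℝ := (∑ i, pathSum r N p n (subtreeAt i V)) ^ (1 / p) with hQ
    have hQ0 : 0 ≤ Q := Real.rpow_nonneg (Finset.sum_nonneg fun i _ => pathSum_nonneg _ _ _ _) _
    have hpath : pathSum r N p (n + 1) V ^ (1 / p) = rootShare r (childCounts V) * Q := by
      rw [pathSum, if_neg (not_lt.2 h), Real.mul_rpow (Real.rpow_nonneg (rootShare_nonneg _) _)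
        (Finset.sum_nonneg fun i _ => pathSum_nonneg _ _ _ _), ← Real.rpow_mul (rootShare_nonneg _),
        mul_one_div_cancel hp.ne', Real.rpow_one]
    have hterm : ∀ i ∈ I, (largestArySubtree r (subtreeAt i V) : ℝ) ≤
        smallBound r D n + (d + 1) * Q * childCounts V i := by
      intro i _
      refine (ih (hV.subtree hroot i)).trans ?_
      have h1 : pathSum r N p n (subtreeAt i V) ^ (1 / p) ≤ Q :=
        Real.rpow_le_rpow (pathSum_nonneg _ _ _ _)
          (Finset.single_le_sum (f := fun j => pathSum r N p n (subtreeAt j V))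
            (fun j _ => pathSum_nonneg _ _ _ _) (Finset.mem_univ i))
          (by positivity)
      have h2 : ((d : ℝ) + 1) * innerCount (subtreeAt i V) *
          pathSum r N p n (subtreeAt i V) ^ (1 / p) ≤
          ((d : ℝ) + 1) * innerCount (subtreeAt i V) * Q := by gcongr
      unfold childCounts
      linarith
    have h3 : (largestArySubtree r V : ℝ) ≤
        1 + ∑ i ∈ I, (largestArySubtree r (subtreeAt i V) : ℝ) := by exact_mod_cast hle
    have h4 := Finset.sum_le_sum hterm
    rw [Finset.sum_add_distrib, ← Finset.mul_sum, Finset.sum_const, nsmul_eq_mul] at h4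
    have h5 : (I.card : ℝ) * smallBound r D n ≤ r * smallBound r D n := by gcongr
    have h6 : (d + 1) * Q * ∑ i ∈ I, (childCounts V i : ℝ) ≤
        (d + 1) * Q * (rootShare r (childCounts V) * innerCount V) := by
      gcongr
      refine (sum_le_rootShare _ hI).trans ?_
      gcongr
      · exact rootShare_nonneg _
      · rw [hV.innerCount_eq hroot hd]
        lia
    rw [hpath, smallBound]
    push_cast
    linarith

end

/-! ### The transition operator of the tree process, and Pólya urns -/

/-- The average of `g` over the trees obtained from `V` by one step of the process. -/
noncomputable def leafAvg {d : ℕ} (g : Finset (List (Fin d)) → ℝ) (V : Finset (List (Fin d))) : ℝ :=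
  (∑ v ∈ treeLeaves V, g (treeGrow V v)) / (treeLeaves V).card

/-- The expectation of `ψ` at the vector of the numbers of balls added in `t` steps to a Pólya urn
with initial weights `α`. -/
noncomputable def polyaMean {d : ℕ} : ℕ → (Fin d → ℝ) → ((Fin d → ℕ) → ℝ) → ℝ
  | 0, _, ψ => ψ 0
  | t + 1, α, ψ => ∑ j, α j / (∑ k, α k) *
      polyaMean t (α + Pi.single j 1) fun m => ψ (m + Pi.single j 1)

section

variable {d r : ℕ}

/-- The initial weight of the colours of the urn embedded in the tree process. -/
local notation "urnWeight" => (1 / ((d : ℝ) - 1))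

/-- A subtree with `m` inner vertices has `(d - 1) * (m + 1 / (d - 1))` leaves. A uniform leaf thus
selects a subtree with the Pólya urn probabilities, and is then uniform among the leaves of that
subtree. -/
theorem leafAvg_eq (hd : 1 < d) {V : Finset (List (Fin d))} (hV : IsFullTree V)
    (h : 0 < innerCount V) (g : Finset (List (Fin d)) → ℝ) :
    leafAvg g V = ∑ j, (urnWeight + childCounts V j) / (∑ k, (urnWeight + childCounts V k)) *
      ((∑ u ∈ treeLeaves (subtreeAt j V), g (treeGrow V (u ++ [j]))) /
        (treeLeaves (subtreeAt j V)).card) := by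
  have hroot := hV.singleton_mem h
  have hd1 : (0 : ℝ) < (d : ℝ) - 1 := by
    have : (1 : ℝ) < d := by exact_mod_cast hd
    linarith
  rw [leafAvg, sum_treeLeaves hroot (by lia), Finset.sum_div]
  refine Finset.sum_congr rfl fun j _ => ?_
  have h1 := (hV.subtree hroot j).card_treeLeaves
  have h2 := hV.card_treeLeaves
  rw [hV.innerCount_eq hroot hd] at h2
  push_cast at h2
  have h3 : (0 : ℝ) < (treeLeaves (subtreeAt j V)).card := by
    rw [h1]; positivity
  have h4 : urnWeight + childCounts V j = (treeLeaves (subtreeAt j V)).card / ((d : ℝ) - 1) := by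
    rw [h1, childCounts]; field_simp; ring
  have h5 : (∑ k, (urnWeight + (childCounts V k : ℝ))) = (treeLeaves V).card / ((d : ℝ) - 1) := by
    rw [Finset.sum_add_distrib, h2]
    simp only [Finset.sum_const, Finset.card_univ, Fintype.card_fin, nsmul_eq_mul]
    field_simp
    ring
  rw [h4, h5]
  field_simp

theorem leafAvg_const {V : Finset (List (Fin d))} (hd : 0 < d) (hV : IsFullTree V) (c : ℝ) :
    leafAvg (fun _ => c) V = c := by
  have h := Finset.card_pos.2 (hV.treeLeaves_nonempty hd)
  have : ((treeLeaves V).card : ℝ) ≠ 0 := by exact_mod_cast h.ne'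
  simp only [leafAvg, Finset.sum_const, nsmul_eq_mul]
  field_simp

theorem leafAvg_childCounts (hd : 1 < d) {V : Finset (List (Fin d))} (hV : IsFullTree V)
    (h : 0 < innerCount V) (ψ : (Fin d → ℕ) → ℝ) :
    leafAvg (fun W => ψ (childCounts W)) V =
      ∑ j, (urnWeight + childCounts V j) / (∑ k, (urnWeight + childCounts V k)) *
        ψ (childCounts V + Pi.single j 1) := by
  have hroot := hV.singleton_mem h
  rw [leafAvg_eq hd hV h]
  refine Finset.sum_congr rfl fun j _ => ?_
  congr 1
  rw [Finset.sum_congr rfl fun u hu => by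
    rw [hV.childCounts_grow hroot (by lia) hu]]
  exact leafAvg_const (by lia) (hV.subtree hroot j) (ψ (childCounts V + Pi.single j 1))

theorem leafAvg_childCounts_mul (hd : 1 < d) {V : Finset (List (Fin d))} (hV : IsFullTree V)
    (h : 0 < innerCount V) (ψ : (Fin d → ℕ) → ℝ) (g : Finset (List (Fin d)) → ℝ) (i : Fin d) :
    leafAvg (fun W => ψ (childCounts W) * g (subtreeAt i W)) V =
      ∑ j, (urnWeight + childCounts V j) / (∑ k, (urnWeight + childCounts V k)) *
        ψ (childCounts V + Pi.single j 1) *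
          (if j = i then leafAvg g else g) (subtreeAt i V) := by
  have hroot := hV.singleton_mem h
  rw [leafAvg_eq hd hV h]
  refine Finset.sum_congr rfl fun j _ => ?_
  rw [mul_assoc]
  congr 1
  rw [Finset.sum_congr rfl fun u hu => by
    rw [hV.childCounts_grow hroot (by lia) hu], ← Finset.mul_sum, mul_div_assoc]
  congr 1
  split_ifs with hji
  · subst hji
    simp only [subtreeAt_grow_same]
    rfl
  · simp only [subtreeAt_grow_ne (Ne.symm hji)]
    exact leafAvg_const (by lia) (hV.subtree hroot j) (g (subtreeAt i V))

theorem iterate_leafAvg_const (hd : 0 < d) (c : ℝ) : ∀ (t : ℕ) {V : Finset (List (Fin d))},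
    IsFullTree V → leafAvg^[t] (fun _ => c) V = c
  | 0, _, _ => rfl
  | t + 1, V, hV => by
    rw [Function.iterate_succ_apply', leafAvg, Finset.sum_congr rfl fun v hv =>
      iterate_leafAvg_const hd c t (hV.grow (treeLeaves_subset hv))]
    exact leafAvg_const hd hV c

theorem polyaMean_mul_const (c : ℝ) : ∀ (t : ℕ) (α : Fin d → ℝ) (ψ : (Fin d → ℕ) → ℝ),
    polyaMean t α (fun m => ψ m * c) = polyaMean t α ψ * c
  | 0, _, _ => rfl
  | t + 1, α, ψ => by
    simp only [polyaMean, Finset.sum_mul, mul_assoc, polyaMean_mul_const c t _ fun m =>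
      ψ (m + Pi.single _ 1)]

theorem leafAvg_sum {ι : Type*} (s : Finset ι) (g : ι → Finset (List (Fin d)) → ℝ) :
    leafAvg (fun V => ∑ j ∈ s, g j V) = fun V => ∑ j ∈ s, leafAvg (g j) V := by
  ext V
  simp only [leafAvg]
  rw [Finset.sum_comm, Finset.sum_div]

theorem iterate_leafAvg_sum {ι : Type*} (s : Finset ι) : ∀ (t : ℕ)
    (g : ι → Finset (List (Fin d)) → ℝ) (V : Finset (List (Fin d))),
    leafAvg^[t] (fun V => ∑ j ∈ s, g j V) V = ∑ j ∈ s, leafAvg^[t] (g j) V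
  | 0, _, _ => rfl
  | t + 1, g, V => by
    simp only [Function.iterate_succ_apply]
    rw [leafAvg_sum, iterate_leafAvg_sum s t fun j => leafAvg (g j)]

/-- Comparison is needed only on trees reachable in `t` steps; each step keeps the tree full and
adds exactly one inner vertex. -/
theorem iterate_leafAvg_mono (hd : 0 < d) : ∀ (t : ℕ) {F G : Finset (List (Fin d)) → ℝ}
    {V : Finset (List (Fin d))}, IsFullTree V →
    (∀ W, IsFullTree W → innerCount W = innerCount V + t → F W ≤ G W) →
    leafAvg^[t] F V ≤ leafAvg^[t] G V
  | 0, _, _, V, hV, h => h V hV rfl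
  | t + 1, F, G, V, hV, h => by
    simp only [Function.iterate_succ_apply', leafAvg]
    gcongr with v hv
    refine iterate_leafAvg_mono hd t (hV.grow (treeLeaves_subset hv)) fun W hW hc => h W hW ?_
    rw [hc, hV.innerCount_grow hd hv]
    lia

theorem iterate_leafAvg_congr (hd : 0 < d) (t : ℕ) {F G : Finset (List (Fin d)) → ℝ}
    {V : Finset (List (Fin d))} (hV : IsFullTree V)
    (h : ∀ W, IsFullTree W → innerCount W = innerCount V + t → F W = G W) :
    leafAvg^[t] F V = leafAvg^[t] G V :=
  le_antisymm (iterate_leafAvg_mono hd t hV fun W hW hc => (h W hW hc).le)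
    (iterate_leafAvg_mono hd t hV fun W hW hc => (h W hW hc).ge)

theorem iterate_leafAvg_childCounts (hd : 1 < d) : ∀ (t : ℕ) {V : Finset (List (Fin d))},
    IsFullTree V → 0 < innerCount V → ∀ ψ : (Fin d → ℕ) → ℝ,
    leafAvg^[t] (fun W => ψ (childCounts W)) V =
      polyaMean t (fun j => urnWeight + childCounts V j) fun m => ψ (m + childCounts V)
  | 0, V, hV, h, ψ => by simp [polyaMean]
  | t + 1, V, hV, h, ψ => by
    have hroot := hV.singleton_mem h
    -- The outermost average is the first step in time, matching the first draw in `polyaMean`.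
    rw [Function.iterate_succ_apply', leafAvg_eq hd hV h, polyaMean]
    refine Finset.sum_congr rfl fun j _ => ?_
    congr 1
    rw [Finset.sum_congr rfl fun u hu => by
      have hu' := mem_treeLeaves_subtreeAt.1 hu
      rw [iterate_leafAvg_childCounts hd t (hV.grow (treeLeaves_subset hu'))
        (by rw [hV.innerCount_grow (by lia) hu']; lia),
        hV.childCounts_grow hroot (by lia) hu]]
    refine (leafAvg_const (by lia) (hV.subtree hroot j) _).trans ?_
    congr 1
    · ext k
      rcases eq_or_ne k j with rfl | hk
      · simp [add_assoc]
      · simp [hk]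
    · ext m
      rw [add_assoc, add_comm (Pi.single j 1)]

/-- Given the counts, the subtree at `i` is distributed as the process run for its own number of
steps. The induction peels off the last step in time: it either applies `leafAvg` once more to `g`,
when the count at `i` goes up, or leaves `g` alone. The urn weight is absorbed into `ψ`. -/
theorem iterate_leafAvg_childCounts_mul (hd : 1 < d) (i : Fin d) {V : Finset (List (Fin d))}
    (hV : IsFullTree V) (h : 0 < innerCount V) (hi : subtreeAt i V = {[]}) : ∀ (t : ℕ)
    (ψ : (Fin d → ℕ) → ℝ) (g : Finset (List (Fin d)) → ℝ),
    leafAvg^[t] (fun W => ψ (childCounts W) * g (subtreeAt i W)) V =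
      leafAvg^[t] (fun W => ψ (childCounts W) * leafAvg^[childCounts W i] g {[]}) V
  | 0, ψ, g => by
    simp [childCounts, hi, innerCount_singleton]
  | t + 1, ψ, g => by
    simp only [Function.iterate_succ_apply]
    rw [iterate_leafAvg_congr (by lia) t hV fun W hW hc =>
      leafAvg_childCounts_mul hd hW (by lia) ψ g i, iterate_leafAvg_sum]
    rw [iterate_leafAvg_congr (by lia) t hV fun W hW hc =>
      leafAvg_childCounts hd hW (by lia) fun m => ψ m * leafAvg^[m i] g {[]}, iterate_leafAvg_sum]
    refine Finset.sum_congr rfl fun j _ => ?_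
    refine (iterate_leafAvg_childCounts_mul hd i hV h hi t
      (fun m => (urnWeight + m j) / (∑ k, (urnWeight + m k)) * ψ (m + Pi.single j 1))
      (if j = i then leafAvg g else g)).trans ?_
    refine iterate_leafAvg_congr (by lia) t hV fun W _ _ => ?_
    rw [mul_assoc]
    congr 2
    split_ifs with hji
    · subst hji
      rw [← Function.iterate_succ_apply, Pi.add_apply, Pi.single_eq_same]
    · simp [Pi.single_eq_of_ne (Ne.symm hji)]

theorem leafAvg_singleton (g : Finset (List (Fin d)) → ℝ) :
    leafAvg g {[]} = g (treeGrow {[]} []) := by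
  rw [leafAvg, treeLeaves_singleton]
  simp

theorem subtreeAt_star (i : Fin d) : subtreeAt i (treeGrow {[]} []) = {[]} := by
  ext u
  simp only [mem_subtreeAt, mem_treeGrow, Finset.mem_singleton]
  constructor
  · rintro (h | ⟨j, hj⟩)
    · simp at h
    · exact ((List.append_inj' (s₁ := []) hj rfl).1).symm
  · rintro rfl
    exact .inr ⟨i, rfl⟩

/-- The mean path sum decays geometrically in the length of the paths. -/
theorem iterate_leafAvg_pathSum_le (hd : 1 < d) {N : ℕ} (hN : 0 < N) (p : ℝ) {θ : ℝ}
    (hθ : ∀ t, N ≤ t + 1 → d * polyaMean t (fun _ : Fin d => urnWeight)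
      (fun m => rootShare r m ^ p) ≤ θ) (hθ0 : 0 ≤ θ) : ∀ n t,
    leafAvg^[t] (pathSum (d := d) r N p n) {[]} ≤ θ ^ n
  | 0, t => (iterate_leafAvg_const (by lia) 1 t isFullTree_singleton).le
  | n + 1, t => by
    rcases lt_or_ge t N with h | h
    · refine (iterate_leafAvg_mono (by lia) (G := fun _ => 0) t isFullTree_singleton
        fun W _ hc => ?_).trans ?_
      · rw [innerCount_singleton, zero_add] at hc
        rw [pathSum, if_pos (hc ▸ h)]
      · rw [iterate_leafAvg_const (by lia) 0 t isFullTree_singleton]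
        positivity
    -- The first step always splits the root, so only `s = t - 1` draws are made from the urn. This
    -- is the shift `N ≤ t + 1` in `hθ`.
    obtain ⟨s, rfl⟩ : ∃ s, t = s + 1 := ⟨t - 1, by lia⟩
    have hstar : IsFullTree (treeGrow {[]} [] : Finset (List (Fin d))) :=
      isFullTree_singleton.grow (by simp)
    have hcount : innerCount (treeGrow {[]} [] : Finset (List (Fin d))) = 1 := by
      have hl : [] ∈ treeLeaves ({[]} : Finset (List (Fin d))) := by
        simp [treeLeaves_singleton]
      rw [isFullTree_singleton.innerCount_grow (by lia) hl, innerCount_singleton]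
    have hzero : childCounts (treeGrow {[]} [] : Finset (List (Fin d))) = 0 := by
      ext i
      rw [childCounts, subtreeAt_star, innerCount_singleton, Pi.zero_apply]
    rw [Function.iterate_succ_apply', leafAvg_singleton]
    rw [iterate_leafAvg_congr (by lia) s hstar (G := fun W => ∑ i, (fun m => rootShare r m ^ p)
      (childCounts W) * pathSum r N p n (subtreeAt i W)) fun W hW hc => by
        rw [pathSum, if_neg (by lia), Finset.mul_sum], iterate_leafAvg_sum]
    have hle : ∀ i ∈ (Finset.univ : Finset (Fin d)), leafAvg^[s] (fun W =>
        (fun m => rootShare r m ^ p) (childCounts W) * pathSum r N p n (subtreeAt i W))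
        (treeGrow {[]} []) ≤ polyaMean s (fun _ : Fin d => urnWeight)
          (fun m => rootShare r m ^ p) * θ ^ n := by
      intro i _
      refine (iterate_leafAvg_childCounts_mul hd i hstar (by lia) (subtreeAt_star i) s
        (fun m => rootShare r m ^ p) (pathSum r N p n)).trans_le ?_
      refine (iterate_leafAvg_mono (by lia) s hstar (G := fun W =>
        (fun m => rootShare r m ^ p * θ ^ n) (childCounts W)) fun W _ _ => ?_).trans_eq ?_
      · exact mul_le_mul_of_nonneg_left (iterate_leafAvg_pathSum_le hd hN p hθ hθ0 n _)
          (Real.rpow_nonneg (rootShare_nonneg _) _)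
      · refine (iterate_leafAvg_childCounts hd s hstar (by lia)
          fun m => rootShare r m ^ p * θ ^ n).trans ?_
        simp [hzero, polyaMean_mul_const]
    refine (Finset.sum_le_sum hle).trans ?_
    rw [Finset.sum_const, Finset.card_univ, Fintype.card_fin, nsmul_eq_mul, ← mul_assoc, pow_succ']
    exact mul_le_mul_of_nonneg_right (hθ s h) (by positivity)

end

/-! ### The Dirichlet distribution -/

section

open ProbabilityTheory

/-- Integrals of products over a finite power of the line. -/
theorem lintegral_fin_prod_eq_prod : ∀ {n : ℕ} (f : Fin n → ℝ → ENNReal),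
    (∀ i, Measurable (f i)) → ∫⁻ x : Fin n → ℝ, ∏ i, f i (x i) = ∏ i, ∫⁻ x, f i x
  | 0, f, _ => by simp [volume_pi]
  | n + 1, f, hf => by
    have hm : Measurable fun x : Fin n → ℝ => ∏ i, f i.succ (x i) :=
      Finset.measurable_prod _ fun i _ => (hf _).comp (measurable_pi_apply i)
    have hm' : Measurable fun x : Fin (n + 1) → ℝ => ∏ i, f i (x i) :=
      Finset.measurable_prod _ fun i _ => (hf _).comp (measurable_pi_apply i)
    rw [← ((volume_preserving_piFinSuccAbove (fun _ => ℝ) 0).symm).lintegral_comp hm']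
    simp only [MeasurableEquiv.piFinSuccAbove_symm_apply, Fin.insertNthEquiv, Equiv.coe_fn_mk,
      Fin.prod_univ_succ, Fin.insertNth_zero', Fin.cons_zero, Fin.cons_succ]
    rw [Measure.volume_eq_prod, lintegral_prod_mul (hf 0).aemeasurable hm.aemeasurable,
      lintegral_fin_prod_eq_prod _ fun i => hf i.succ]

theorem lintegral_comp_smul_pi {n : ℕ} (f : (Fin n → ℝ) → ENNReal) {s : ℝ} (hs : 0 < s) :
    ∫⁻ x, f x = ENNReal.ofReal (s ^ n) * ∫⁻ u, f (s • u) := by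
  have h1 : ∫⁻ u : Fin n → ℝ, f (s • u) = ENNReal.ofReal (s ^ n)⁻¹ * ∫⁻ x, f x := by
    have h := Measure.map_addHaar_smul (volume : Measure (Fin n → ℝ)) hs.ne'
    rw [Module.finrank_fin_fun, abs_of_pos (by positivity)] at h
    rw [← smul_eq_mul, ← lintegral_smul_measure, ← h]
    exact (lintegral_map_equiv f (MeasurableEquiv.smul₀ s hs.ne')).symm
  rw [h1, ← mul_assoc, ← ENNReal.ofReal_mul (by positivity), mul_inv_cancel₀ (by positivity)]
  simp

/-- Integrals over a finite power of the line, in terms of the sum of the coordinates and of all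
coordinates but the last. -/
theorem lintegral_pi_eq_sum_coordinate {n : ℕ} {f : (Fin (n + 1) → ℝ) → ENNReal}
    (hf : Measurable f) :
    ∫⁻ y, f y = ∫⁻ s : ℝ, ∫⁻ x : Fin n → ℝ, f (Fin.snoc x (s - ∑ i, x i)) := by
  have hsn : Measurable fun p : ℝ × (Fin n → ℝ) => (Fin.snoc p.2 p.1 : Fin (n + 1) → ℝ) := by
    refine measurable_pi_lambda _ fun i => ?_
    induction i using Fin.lastCases with
    | last => simpa using measurable_fst
    | cast i => simpa [Function.comp_def] using (measurable_pi_apply i).comp measurable_snd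
  rw [← ((volume_preserving_piFinSuccAbove (fun _ => ℝ) (Fin.last n)).symm).lintegral_comp hf]
  simp only [MeasurableEquiv.piFinSuccAbove_symm_apply, Fin.insertNthEquiv, Equiv.coe_fn_mk,
    Fin.insertNth_last']
  rw [Measure.volume_eq_prod, lintegral_prod_symm' (fun p : ℝ × (Fin n → ℝ) =>
    f (Fin.snoc p.2 p.1)) (hf.comp hsn), lintegral_lintegral_swap
    (f := fun (s : ℝ) (x : Fin n → ℝ) => f (Fin.snoc x (s - ∑ i, x i)))]
  · refine lintegral_congr fun x => ?_
    exact (lintegral_sub_right_eq_self (fun z => f (Fin.snoc x z)) (∑ i, x i)).symm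
  · have h : Measurable fun p : ℝ × (Fin n → ℝ) => (p.1 - ∑ i, p.2 i, p.2) := by fun_prop
    exact ((hf.comp hsn).comp h).aemeasurable

/-- The gamma density with rate one, put to zero at the origin. -/
noncomputable def posGamma (a x : ℝ) : ENNReal :=
  ENNReal.ofReal (if 0 < x then x ^ (a - 1) * Real.exp (-x) / Real.Gamma a else 0)

theorem measurable_posGamma (a : ℝ) : Measurable (posGamma a) := by
  refine ENNReal.measurable_ofReal.comp (Measurable.ite measurableSet_Ioi ?_ measurable_const)
  fun_prop

theorem lintegral_posGamma {a : ℝ} (ha : 0 < a) : ∫⁻ x, posGamma a x = 1 := by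
  rw [← lintegral_gammaPDF_eq_one ha one_pos]
  refine lintegral_congr_ae ?_
  filter_upwards [Measure.ae_ne volume (0 : ℝ)] with x hx
  rcases lt_or_gt_of_ne hx with h | h
  · rw [gammaPDF_of_neg h, posGamma, if_neg h.not_gt, ENNReal.ofReal_zero]
  · rw [gammaPDF_of_nonneg h.le, posGamma, if_pos h, Real.one_rpow, one_mul]
    congr 1
    ring

end

section

variable {n : ℕ} {α : Fin (n + 1) → ℝ}

theorem simplexPoint_eq_snoc (x : Fin n → ℝ) :
    (simplexPoint (n := n + 1) x : Fin (n + 1) → ℝ) = Fin.snoc x (1 - ∑ i, x i) := by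
  ext i
  induction i using Fin.lastCases with
  | last => simp [simplexPoint]
  | cast i => simp [simplexPoint]

theorem sum_simplexPoint (x : Fin n → ℝ) : ∑ i, simplexPoint (n := n + 1) x i = 1 := by
  rw [simplexPoint_eq_snoc, Fin.sum_univ_castSucc]
  simp

/-- The total and the proportions of independent gamma variables are independent, with gamma and
Dirichlet laws; `s ^ n` is the Jacobian. Both densities vanish unless all coordinates are strictly
positive, so the identity holds pointwise. -/
theorem prod_posGamma_smul (hα : ∀ i, 0 < α i) {s : ℝ} (hs : 0 < s) (u : Fin n → ℝ) :
    ENNReal.ofReal (s ^ n) * ∏ i, posGamma (α i)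
      ((Fin.snoc (s • u) (s - ∑ i, (s • u) i) : Fin (n + 1) → ℝ) i) =
    posGamma (∑ i, α i) s * ENNReal.ofReal (dirichletDensity α (simplexPoint (n := n + 1) u)) := by
  have h1 : (Fin.snoc (s • u) (s - ∑ i, (s • u) i) : Fin (n + 1) → ℝ) =
      s • simplexPoint (n := n + 1) u := by
    rw [simplexPoint_eq_snoc]
    ext i
    induction i using Fin.lastCases with
    | last => simp [← Finset.mul_sum, mul_sub]
    | cast i => simp
  set y := simplexPoint (n := n + 1) u with hy
  have hsum : ∑ i, y i = 1 := sum_simplexPoint u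
  rw [h1]
  have hα' : 0 < ∑ i, α i := Finset.sum_pos (fun i _ => hα i) Finset.univ_nonempty
  have hΓ : 0 < ∏ i, Real.Gamma (α i) :=
    Finset.prod_pos fun i _ => Real.Gamma_pos_of_pos (hα i)
  have hΓ' := Real.Gamma_pos_of_pos hα'
  by_cases hpos : ∀ i, 0 < y i
  · have h2 : ∀ i, posGamma (α i) ((s • y) i) = ENNReal.ofReal
        (s ^ (α i - 1) * y i ^ (α i - 1) * Real.exp (-(s * y i)) / Real.Gamma (α i)) := by
      intro i
      have : 0 < (s • y) i := mul_pos hs (hpos i)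
      rw [posGamma, if_pos this, Pi.smul_apply, smul_eq_mul, Real.mul_rpow hs.le (hpos i).le]
    have h3 : ∀ i, 0 ≤ s ^ (α i - 1) * y i ^ (α i - 1) * Real.exp (-(s * y i)) /
        Real.Gamma (α i) := by
      intro i
      have := Real.Gamma_pos_of_pos (hα i)
      have := (hpos i)
      positivity
    simp only [h2]
    rw [← ENNReal.ofReal_prod_of_nonneg fun i _ => h3 i, ← ENNReal.ofReal_mul (by positivity),
      posGamma, if_pos hs, ← ENNReal.ofReal_mul (by positivity), dirichletDensity, if_pos hpos]
    congr 1
    rw [Finset.prod_div_distrib, Finset.prod_mul_distrib, Finset.prod_mul_distrib,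
      ← Real.rpow_sum_of_pos hs, ← Real.exp_sum, Finset.sum_neg_distrib, ← Finset.mul_sum, hsum,
      Finset.sum_sub_distrib]
    simp only [Finset.sum_const, Finset.card_univ, Fintype.card_fin, nsmul_eq_mul, mul_one]
    have h5 : s ^ (∑ i, α i - 1) = s ^ n * s ^ (∑ i, α i - ((n + 1 : ℕ) : ℝ)) := by
      rw [← Real.rpow_natCast, ← Real.rpow_add hs]
      congr 1
      push_cast
      ring
    rw [h5]
    field_simp
  · rw [dirichletDensity, if_neg hpos]
    push Not at hpos
    obtain ⟨i, hi⟩ := hpos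
    have h2 : posGamma (α i) ((s • y) i) = 0 := by
      have : ¬ 0 < (s • y) i := not_lt.2 (mul_nonpos_of_nonneg_of_nonpos hs.le hi)
      rw [posGamma, if_neg this, ENNReal.ofReal_zero]
    rw [Finset.prod_eq_zero (Finset.mem_univ i) h2]
    simp

theorem prod_posGamma_of_nonpos {s : ℝ} (hs : s ≤ 0) (x : Fin n → ℝ) :
    ∏ i, posGamma (α i) ((Fin.snoc x (s - ∑ i, x i) : Fin (n + 1) → ℝ) i) = 0 := by
  by_contra hc
  have h : ∀ i, 0 < (Fin.snoc x (s - ∑ i, x i) : Fin (n + 1) → ℝ) i := by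
    intro i
    by_contra hi
    refine hc (Finset.prod_eq_zero (Finset.mem_univ i) ?_)
    rw [posGamma, if_neg hi, ENNReal.ofReal_zero]
  have h2 := Finset.sum_pos (fun i _ => h i) Finset.univ_nonempty
  rw [Fin.sum_univ_castSucc] at h2
  simp only [Fin.snoc_castSucc, Fin.snoc_last] at h2
  linarith

theorem measurable_dirichletDensity {n : ℕ} {α : Fin n → ℝ} : Measurable (dirichletDensity α) := by
  refine Measurable.ite ?_ ?_ measurable_const
  · rw [Set.ofPred_forall]
    exact MeasurableSet.iInter fun i => measurableSet_lt measurable_const (measurable_pi_apply i)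
  · exact (Finset.measurable_prod _ fun i _ =>
      (measurable_pi_apply i).pow_const _).const_mul _

/-- The product of gamma densities has mass one. In the coordinates (total, proportions) this mass
is the Dirichlet mass times that of a gamma density. -/
theorem lintegral_dirichletDensity (hα : ∀ i, 0 < α i) :
    ∫⁻ x : Fin n → ℝ, ENNReal.ofReal (dirichletDensity α (simplexPoint (n := n + 1) x)) = 1 := by
  have hα' : 0 < ∑ i, α i := Finset.sum_pos (fun i _ => hα i) Finset.univ_nonempty
  have h1 := lintegral_fin_prod_eq_prod (fun i => posGamma (α i)) fun i => measurable_posGamma _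
  simp only [lintegral_posGamma (hα _), Finset.prod_const_one] at h1
  have hm : Measurable fun y : Fin (n + 1) → ℝ => ∏ i, posGamma (α i) (y i) :=
    Finset.measurable_prod _ fun i _ => (measurable_posGamma _).comp (measurable_pi_apply i)
  rw [lintegral_pi_eq_sum_coordinate hm] at h1
  have h2 : ∀ s : ℝ, ∫⁻ x : Fin n → ℝ, ∏ i, posGamma (α i)
      ((Fin.snoc x (s - ∑ i, x i) : Fin (n + 1) → ℝ) i) = posGamma (∑ i, α i) s *
      ∫⁻ x : Fin n → ℝ, ENNReal.ofReal (dirichletDensity α (simplexPoint (n := n + 1) x)) := by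
    intro s
    rcases le_or_gt s 0 with hs | hs
    · simp only [prod_posGamma_of_nonpos hs]
      simp [posGamma, not_lt.2 hs]
    · rw [lintegral_comp_smul_pi _ hs, ← lintegral_const_mul' _ _ ENNReal.ofReal_ne_top]
      simp only [prod_posGamma_smul hα hs]
      rw [lintegral_const_mul']
      exact ENNReal.ofReal_ne_top
  simp only [h2] at h1
  rwa [lintegral_mul_const _ (measurable_posGamma _), lintegral_posGamma hα', one_mul] at h1

end

/-! ### Dirichlet integrals and size-biasing -/

section

variable {d : ℕ} {α : Fin d → ℝ}

theorem isProbabilityMeasure_dirichletMeasure (hd : 0 < d) (hα : ∀ i, 0 < α i) :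
    IsProbabilityMeasure (dirichletMeasure α) := by
  obtain ⟨n, rfl⟩ : ∃ n, d = n + 1 := ⟨d - 1, by lia⟩
  have : IsProbabilityMeasure ((volume : Measure (Fin (n + 1 - 1) → ℝ)).withDensity fun x =>
      ENNReal.ofReal (dirichletDensity α (simplexPoint x))) :=
    ⟨by rw [withDensity_apply _ MeasurableSet.univ, Measure.restrict_univ]
        exact lintegral_dirichletDensity hα⟩
  exact Measure.isProbabilityMeasure_map measurable_simplexPoint.aemeasurable

theorem dirichletDensity_nonneg (hα : ∀ i, 0 < α i) (y : Fin d → ℝ) :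
    0 ≤ dirichletDensity α y := by
  rw [dirichletDensity]
  split_ifs with h
  · have h1 : 0 < ∏ i, Real.Gamma (α i) :=
      Finset.prod_pos fun i _ => Real.Gamma_pos_of_pos (hα i)
    have h2 : 0 ≤ Real.Gamma (∑ i, α i) :=
      Real.Gamma_nonneg_of_nonneg (Finset.sum_nonneg fun i _ => (hα i).le)
    have h3 : 0 ≤ ∏ i, y i ^ (α i - 1) :=
      Finset.prod_nonneg fun i _ => Real.rpow_nonneg (h i).le _
    positivity
  · exact le_rfl

theorem integral_dirichletMeasure (hα : ∀ i, 0 < α i) {f : (Fin d → ℝ) → ℝ} (hf : Continuous f) :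
    ∫ y, f y ∂(dirichletMeasure α) =
      ∫ x, dirichletDensity α (simplexPoint x) * f (simplexPoint x) := by
  rw [dirichletMeasure, integral_map measurable_simplexPoint.aemeasurable
    hf.aestronglyMeasurable, integral_withDensity_eq_integral_toReal_smul]
  · refine integral_congr_ae (ae_of_all _ fun x => ?_)
    simp only [ENNReal.toReal_ofReal (dirichletDensity_nonneg hα _), smul_eq_mul]
  · exact (measurable_dirichletDensity.comp measurable_simplexPoint).ennreal_ofReal
  · simp

theorem ae_dirichletMeasure (hd : 0 < d) :
    ∀ᵐ y ∂(dirichletMeasure α), (∀ i, 0 ≤ y i) ∧ ∑ i, y i = 1 := by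
  obtain ⟨n, rfl⟩ : ∃ n, d = n + 1 := ⟨d - 1, by lia⟩
  have hm : Measurable fun x : Fin (n + 1 - 1) → ℝ =>
      ENNReal.ofReal (dirichletDensity α (simplexPoint x)) :=
    (measurable_dirichletDensity.comp measurable_simplexPoint).ennreal_ofReal
  rw [dirichletMeasure, ae_map_iff measurable_simplexPoint.aemeasurable, ae_withDensity_iff hm]
  · refine ae_of_all _ fun x hx => ⟨fun i => ?_, sum_simplexPoint x⟩
    by_contra hi
    refine hx ?_
    rw [dirichletDensity, if_neg fun h => hi (h i).le, ENNReal.ofReal_zero]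
  · have h1 : MeasurableSet {y : Fin (n + 1) → ℝ | ∀ i, 0 ≤ y i} := by
      rw [Set.ofPred_forall]
      exact MeasurableSet.iInter fun i => measurableSet_le measurable_const (measurable_pi_apply i)
    exact h1.inter (measurableSet_eq_fun (by fun_prop) measurable_const)

theorem add_single_pos (hα : ∀ i, 0 < α i) (j i : Fin d) :
    0 < (α + Pi.single j 1 : Fin d → ℝ) i := by
  have h2 : (0 : ℝ) ≤ (Pi.single j 1 : Fin d → ℝ) i := by
    rw [Pi.single_apply]
    split_ifs <;> simp
  exact add_pos_of_pos_of_nonneg (hα i) h2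

/-- Two uses of `Γ (a + 1) = a * Γ a`: weighting by a coordinate raises its parameter by one, at the
cost of the urn's drawing probability. -/
theorem dirichletDensity_add_single (hα : ∀ i, 0 < α i) (j : Fin d) (y : Fin d → ℝ) :
    dirichletDensity α y * y j =
      α j / (∑ k, α k) * dirichletDensity (α + Pi.single j 1) y := by
  have hα' : 0 < ∑ i, α i := Finset.sum_pos (fun i _ => hα i) ⟨j, Finset.mem_univ j⟩
  have hsum : ∑ i, (α + Pi.single j 1 : Fin d → ℝ) i = ∑ i, α i + 1 := by
    simp [Finset.sum_add_distrib]
  rw [dirichletDensity, dirichletDensity, hsum]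
  split_ifs with h
  · have h1 : ∏ i, Real.Gamma ((α + Pi.single j 1 : Fin d → ℝ) i) =
        α j * ∏ i, Real.Gamma (α i) := by
      rw [← Finset.mul_prod_erase _ _ (Finset.mem_univ j),
        ← Finset.mul_prod_erase _ (fun i => Real.Gamma (α i)) (Finset.mem_univ j)]
      rw [Finset.prod_congr rfl fun i hi => by
        rw [Pi.add_apply, Pi.single_eq_of_ne (Finset.ne_of_mem_erase hi), add_zero]]
      rw [Pi.add_apply, Pi.single_eq_same, Real.Gamma_add_one (hα j).ne', mul_assoc]
    have h2 : ∏ i, y i ^ ((α + Pi.single j 1 : Fin d → ℝ) i - 1) = y j * ∏ i, y i ^ (α i - 1) := by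
      rw [← Finset.mul_prod_erase _ _ (Finset.mem_univ j),
        ← Finset.mul_prod_erase _ (fun i => y i ^ (α i - 1)) (Finset.mem_univ j)]
      rw [Finset.prod_congr rfl fun i hi => by
        rw [Pi.add_apply, Pi.single_eq_of_ne (Finset.ne_of_mem_erase hi), add_zero]]
      rw [Pi.add_apply, Pi.single_eq_same, add_sub_right_comm, Real.rpow_add_one (h j).ne']
      ring
    have h3 : 0 < ∏ i, Real.Gamma (α i) :=
      Finset.prod_pos fun i _ => Real.Gamma_pos_of_pos (hα i)
    rw [h1, h2, Real.Gamma_add_one hα'.ne']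
    have := hα j
    field_simp
  · simp

theorem integral_mul_dirichletMeasure (hα : ∀ i, 0 < α i) (j : Fin d) {f : (Fin d → ℝ) → ℝ}
    (hf : Continuous f) :
    ∫ y, y j * f y ∂(dirichletMeasure α) =
      α j / (∑ k, α k) * ∫ y, f y ∂(dirichletMeasure (α + Pi.single j 1)) := by
  have hα' := add_single_pos hα j
  rw [integral_dirichletMeasure hα (f := fun y => y j * f y) ((continuous_apply j).mul hf),
    integral_dirichletMeasure hα' hf,
    ← integral_const_mul]
  refine integral_congr_ae (ae_of_all _ fun x => ?_)
  simp only
  rw [← mul_assoc, dirichletDensity_add_single hα, mul_assoc]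

/-- The measure is finite and carried by the cube `[0, 1] ^ d`, where a continuous function is
bounded. -/
theorem integrable_dirichletMeasure (hd : 0 < d) (hα : ∀ i, 0 < α i) {f : (Fin d → ℝ) → ℝ}
    (hf : Continuous f) : Integrable f (dirichletMeasure α) := by
  have := isProbabilityMeasure_dirichletMeasure hd hα
  obtain ⟨C, hC⟩ := (isCompact_univ_pi fun _ : Fin d => isCompact_Icc (a := (0 : ℝ))
    (b := 1)).exists_bound_of_continuousOn hf.continuousOn
  refine Integrable.of_bound hf.aestronglyMeasurable C ?_
  filter_upwards [ae_dirichletMeasure (α := α) hd] with y hy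
  refine hC y fun i _ => ⟨hy.1 i, ?_⟩
  rw [← hy.2]
  exact Finset.single_le_sum (fun j _ => hy.1 j) (Finset.mem_univ i)

end

/-! ### De Finetti's representation of Pólya urns -/

/-- The expectation of `ψ` at the vector of the numbers of occurrences of the colours in `t`
independent draws with probabilities `x`. -/
noncomputable def multinomialMean {d : ℕ} :
    ℕ → (Fin d → ℝ) → ((Fin d → ℕ) → ℝ) → ℝ
  | 0, _, ψ => ψ 0
  | t + 1, x, ψ => ∑ j, x j * multinomialMean t x fun m => ψ (m + Pi.single j 1)

section

variable {d r : ℕ} {α x : Fin d → ℝ}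

theorem continuous_multinomialMean : ∀ (t : ℕ) (ψ : (Fin d → ℕ) → ℝ),
    Continuous fun x => multinomialMean t x ψ
  | 0, _ => continuous_const
  | t + 1, ψ => by
    simp only [multinomialMean]
    exact continuous_finsetSum _ fun j _ =>
      (continuous_apply j).mul (continuous_multinomialMean t _)

/-- Induction on the number of draws: drawing colour `j` from the urn corresponds to size-biasing
the Dirichlet measure by the `j`-th coordinate. -/
theorem polyaMean_eq_integral (hd : 0 < d) : ∀ (t : ℕ) {α : Fin d → ℝ}, (∀ i, 0 < α i) →
    ∀ ψ : (Fin d → ℕ) → ℝ,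
    polyaMean t α ψ = ∫ x, multinomialMean t x ψ ∂(dirichletMeasure α)
  | 0, α, hα, ψ => by
    have := isProbabilityMeasure_dirichletMeasure hd hα
    simp [polyaMean, multinomialMean]
  | t + 1, α, hα, ψ => by
    simp only [polyaMean, multinomialMean]
    rw [integral_finsetSum]
    · refine Finset.sum_congr rfl fun j _ => ?_
      rw [integral_mul_dirichletMeasure hα j (continuous_multinomialMean t _),
        polyaMean_eq_integral hd t (add_single_pos hα j)]
    · exact fun j _ => integrable_dirichletMeasure hd hα
        ((continuous_apply j).mul (continuous_multinomialMean t _))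

theorem multinomialMean_mono (hx : ∀ i, 0 ≤ x i) : ∀ (t : ℕ) {ψ φ : (Fin d → ℕ) → ℝ},
    (∀ m, ∑ i, m i = t → ψ m ≤ φ m) → multinomialMean t x ψ ≤ multinomialMean t x φ
  | 0, _, _, h => h 0 (by simp)
  | t + 1, _, _, h => by
    simp only [multinomialMean]
    refine Finset.sum_le_sum fun j _ => mul_le_mul_of_nonneg_left
      (multinomialMean_mono hx t fun m hm => h _ ?_) (hx j)
    simp [Finset.sum_add_distrib, hm]

theorem multinomialMean_add : ∀ (t : ℕ) (ψ φ : (Fin d → ℕ) → ℝ),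
    multinomialMean t x (fun m => ψ m + φ m) = multinomialMean t x ψ + multinomialMean t x φ
  | 0, _, _ => rfl
  | t + 1, ψ, φ => by
    simp only [multinomialMean, ← Finset.sum_add_distrib, ← mul_add, ← multinomialMean_add t]

theorem multinomialMean_const_mul (c : ℝ) : ∀ (t : ℕ) (ψ : (Fin d → ℕ) → ℝ),
    multinomialMean t x (fun m => c * ψ m) = c * multinomialMean t x ψ
  | 0, _ => rfl
  | t + 1, ψ => by
    simp only [multinomialMean, Finset.mul_sum]
    exact Finset.sum_congr rfl fun j _ =>
      (congrArg (x j * ·) (multinomialMean_const_mul c t _)).trans (mul_left_comm _ _ _)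

theorem multinomialMean_const (h1 : ∑ i, x i = 1) (c : ℝ) : ∀ t : ℕ,
    multinomialMean t x (fun _ => c) = c
  | 0 => rfl
  | t + 1 => by
    simp only [multinomialMean, multinomialMean_const h1 c t, ← Finset.sum_mul, h1, one_mul]

theorem multinomialMean_sum {ι : Type*} (s : Finset ι) : ∀ (t : ℕ) (ψ : ι → (Fin d → ℕ) → ℝ),
    multinomialMean t x (fun m => ∑ i ∈ s, ψ i m) = ∑ i ∈ s, multinomialMean t x (ψ i)
  | 0, _ => rfl
  | t + 1, ψ => by
    simp only [multinomialMean]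
    rw [Finset.sum_comm]
    exact Finset.sum_congr rfl fun j _ =>
      (congrArg (x j * ·) (multinomialMean_sum s t _)).trans (Finset.mul_sum _ _ _)

/-- Variance plus squared mean. The free shift `c` lets the induction absorb a draw of colour `i`;
later `c = -(t * x i)` isolates the variance. -/
theorem multinomialMean_sq (h1 : ∑ i, x i = 1) (i : Fin d) : ∀ (t : ℕ) (c : ℝ),
    multinomialMean t x (fun m => (m i + c) ^ 2) =
      t * (x i * (1 - x i)) + (t * x i + c) ^ 2
  | 0, c => by simp [multinomialMean]
  | t + 1, c => by
    simp only [multinomialMean]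
    have h : ∀ j, multinomialMean t x (fun m => (((m + Pi.single j 1 : Fin d → ℕ) i : ℝ) + c) ^ 2) =
        t * (x i * (1 - x i)) + (t * x i + c) ^ 2 +
          if j = i then 2 * (t * x i + c) + 1 else 0 := by
      intro j
      split_ifs with hji
      · subst hji
        have h2 := multinomialMean_sq h1 j t (1 + c)
        simp only [Pi.add_apply, Pi.single_eq_same, Nat.cast_add, Nat.cast_one, add_assoc] at h2 ⊢
        rw [h2]
        ring
      · have h2 := multinomialMean_sq h1 i t c
        simp only [Pi.add_apply, Pi.single_eq_of_ne (Ne.symm hji), add_zero]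
        exact h2
    simp only [h, mul_add, Finset.sum_add_distrib, ← Finset.sum_mul, h1, mul_ite, mul_zero,
      Finset.sum_ite_eq', Finset.mem_univ, if_true]
    push_cast
    ring

theorem multinomialMean_sum_sq_le (hx : ∀ i, 0 ≤ x i) (h1 : ∑ i, x i = 1) {t : ℕ} (ht : 0 < t) :
    multinomialMean t x (fun m => ∑ i, ((m i : ℝ) / t - x i) ^ 2) ≤ d / t := by
  have ht' : (0 : ℝ) < t := by exact_mod_cast ht
  rw [multinomialMean_sum]
  have h : ∀ i ∈ (Finset.univ : Finset (Fin d)),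
      multinomialMean t x (fun m => ((m i : ℝ) / t - x i) ^ 2) ≤ 1 / t := by
    intro i _
    have h2 : ∀ m : Fin d → ℕ, ((m i : ℝ) / t - x i) ^ 2 =
        (1 / t ^ 2) * ((m i : ℝ) + -(t * x i)) ^ 2 := by
      intro m
      field_simp
      ring
    simp only [h2]
    rw [multinomialMean_const_mul, multinomialMean_sq h1]
    have h3 : x i * (1 - x i) ≤ 1 := by nlinarith [sq_nonneg (x i - 1), hx i]
    have h4 : 1 / (t : ℝ) ^ 2 * (t * (x i * (1 - x i)) + (t * x i + -(t * x i)) ^ 2) =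
        x i * (1 - x i) / t := by
      field_simp
      ring
    rw [h4]
    gcongr
  refine (Finset.sum_le_sum h).trans_eq ?_
  rw [Finset.sum_const, Finset.card_univ, Fintype.card_fin, nsmul_eq_mul]
  ring

/-- Uniform continuity handles small differences. When `u - v` is at least the modulus `δ`, the term
`s ^ 2 / δ ^ 2` already exceeds `1 ≥ u ^ p`. The quadratic error can be averaged with the variance
bound, for any `p > 0`. -/
theorem exists_rpow_le_add_sq {p ε : ℝ} (hp : 0 < p) (hε : 0 < ε) :
    ∃ C, 0 ≤ C ∧ ∀ u v s : ℝ, 0 ≤ u → u ≤ 1 → 0 ≤ v → v ≤ 1 → u - v ≤ s → 0 ≤ s →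
      u ^ p ≤ v ^ p + ε + C * s ^ 2 := by
  have hc : UniformContinuousOn (fun u : ℝ => u ^ p) (Set.Icc 0 1) :=
    isCompact_Icc.uniformContinuousOn_of_continuous
      (Real.continuous_rpow_const hp.le).continuousOn
  obtain ⟨δ, hδ, h⟩ := Metric.uniformContinuousOn_iff.1 hc ε hε
  refine ⟨1 / δ ^ 2, by positivity, fun u v s hu hu1 hv hv1 hs hs0 => ?_⟩
  have hC : 0 ≤ 1 / δ ^ 2 * s ^ 2 := by positivity
  rcases le_or_gt u v with huv | huv
  · have := Real.rpow_le_rpow hu huv hp.le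
    linarith
  rcases lt_or_ge (u - v) δ with hd | hd
  · have h2 := h u ⟨hu, hu1⟩ v ⟨hv, hv1⟩ (by rw [Real.dist_eq, abs_of_pos] <;> linarith)
    have := (abs_lt.1 (Real.dist_eq _ _ ▸ h2)).2
    linarith
  · have h3 : u ^ p ≤ 1 := Real.rpow_le_one hu hu1 hp.le
    have h4 : 1 ≤ 1 / δ ^ 2 * s ^ 2 := by
      rw [one_div, inv_mul_eq_div, one_le_div (by positivity)]
      exact pow_le_pow_left₀ hδ.le (hd.trans hs) 2
    have := Real.rpow_nonneg hv p
    linarith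

theorem continuous_maxShare : Continuous (maxShare (d := d) r) := by
  refine continuous_const.sub ?_
  exact Continuous.finset_inf'_apply _ fun s _ => continuous_finsetSum _ fun i _ =>
    continuous_apply i

/-- The mean of a power of the largest share of `r` colours in a Pólya urn is asymptotically at
most that under the Dirichlet distribution. -/
theorem exists_polyaMean_rootShare_le (hd : 0 < d) (hα : ∀ i, 0 < α i) {p b : ℝ} (hp : 0 < p)
    (hb : ∫ x, maxShare r x ^ p ∂(dirichletMeasure α) < b) :
    ∃ N, ∀ t, N ≤ t → polyaMean t α (fun m => rootShare r m ^ p) ≤ b := by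
  have hprob := isProbabilityMeasure_dirichletMeasure hd hα
  set I := ∫ x, maxShare r x ^ p ∂(dirichletMeasure α) with hI
  obtain ⟨C, hC0, hC⟩ := exists_rpow_le_add_sq hp (ε := (b - I) / 2) (by linarith)
  -- Half of the gap `b - I` pays for the continuity error, the other half for the variance term `C
  -- * d * (d / t)`.
  obtain ⟨N, hN⟩ := exists_nat_gt (C * d * d / ((b - I) / 2))
  refine ⟨N + 1, fun t ht => ?_⟩
  have ht0 : 0 < t := by lia
  have ht' : (0 : ℝ) < t := by exact_mod_cast ht0
  have hcont : Continuous fun x : Fin d → ℝ => maxShare r x ^ p :=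
    continuous_maxShare.rpow_const fun _ => .inr hp.le
  have hpt : ∀ x : Fin d → ℝ, (∀ i, 0 ≤ x i) → ∑ i, x i = 1 →
      multinomialMean t x (fun m => rootShare r m ^ p) ≤ maxShare r x ^ p + (b - I) := by
    intro x hx h1
    have hle : ∀ m : Fin d → ℕ, ∑ i, m i = t → rootShare r m ^ p ≤
        (maxShare r x ^ p + (b - I) / 2) + C * d * ∑ i, ((m i : ℝ) / t - x i) ^ 2 := by
      intro m hm
      have h2 : rootShare r m = maxShare r fun i => (m i : ℝ) / t := by rw [rootShare, hm]
      have h3 : ∑ i, (m i : ℝ) / t = 1 := by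
        rw [← Finset.sum_div, ← Nat.cast_sum, hm, div_self ht'.ne']
      have h4 := hC (rootShare r m) (maxShare r x) (∑ i, |(m i : ℝ) / t - x i|)
        (rootShare_nonneg m) (h2 ▸ maxShare_le_one fun i => by positivity)
        (maxShare_nonneg hx h1) (maxShare_le_one hx) (h2 ▸ maxShare_sub_le _ _)
        (Finset.sum_nonneg fun i _ => abs_nonneg _)
      have h5 : (∑ i, |(m i : ℝ) / t - x i|) ^ 2 ≤ d * ∑ i, ((m i : ℝ) / t - x i) ^ 2 := by
        have := sq_sum_le_card_mul_sum_sq (s := (Finset.univ : Finset (Fin d)))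
          (f := fun i => |(m i : ℝ) / t - x i|)
        simpa only [sq_abs, Finset.card_univ, Fintype.card_fin] using this
      have h6 := mul_le_mul_of_nonneg_left h5 hC0
      linarith
    refine (multinomialMean_mono hx t hle).trans ?_
    rw [multinomialMean_add, multinomialMean_const h1, multinomialMean_const_mul]
    have h7 : C * d * multinomialMean t x (fun m => ∑ i, ((m i : ℝ) / t - x i) ^ 2) ≤
        C * d * (d / t) :=
      mul_le_mul_of_nonneg_left (multinomialMean_sum_sq_le hx h1 ht0) (by positivity)
    have h8 : C * d * (d / t) ≤ (b - I) / 2 := by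
      rw [div_lt_iff₀ (by linarith)] at hN
      rw [← mul_div_assoc, div_le_iff₀ ht']
      have h9 : (N : ℝ) ≤ t := by exact_mod_cast (by lia : N ≤ t)
      nlinarith
    linarith
  rw [polyaMean_eq_integral hd t hα]
  calc ∫ x, multinomialMean t x (fun m => rootShare r m ^ p) ∂(dirichletMeasure α)
      ≤ ∫ x, (maxShare r x ^ p + (b - I)) ∂(dirichletMeasure α) := by
        refine integral_mono_ae (integrable_dirichletMeasure hd hα (continuous_multinomialMean t _))
          (integrable_dirichletMeasure hd hα (hcont.add continuous_const)) ?_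
        filter_upwards [ae_dirichletMeasure (α := α) hd] with x hx
        exact hpt x hx.1 hx.2
    _ = b := by
        rw [integral_add (integrable_dirichletMeasure hd hα hcont) (integrable_const _)]
        simp [← hI]

/-- A lower bound for the moments of the largest share. -/
theorem inv_rpow_le_integral_maxShare (hr : 0 < r) (hd : 0 < d) (hα : ∀ i, 0 < α i) {p : ℝ}
    (hp : 0 < p) : (1 / (d : ℝ)) ^ p ≤ ∫ x, maxShare r x ^ p ∂(dirichletMeasure α) := by
  have hprob := isProbabilityMeasure_dirichletMeasure hd hα
  have hcont : Continuous fun x : Fin d → ℝ => maxShare r x ^ p :=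
    continuous_maxShare.rpow_const fun _ => .inr hp.le
  have h : ∫ _ : Fin d → ℝ, (1 / (d : ℝ)) ^ p ∂(dirichletMeasure α) = (1 / (d : ℝ)) ^ p := by simp
  rw [← h]
  refine integral_mono_ae (integrable_const _) (integrable_dirichletMeasure hd hα hcont) ?_
  filter_upwards [ae_dirichletMeasure (α := α) hd] with x hx
  have hne : (Finset.univ : Finset (Fin d)).Nonempty := ⟨⟨0, hd⟩, Finset.mem_univ _⟩
  -- Some coordinate is at least the average `1 / d`, and alone it is an admissible choice since `0
  -- < r`.
  obtain ⟨i, -, hi⟩ := Finset.exists_le_of_sum_le (f := fun _ : Fin d => 1 / (d : ℝ)) (g := x) hne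
    (by
      rw [hx.2, Finset.sum_const, Finset.card_univ, Fintype.card_fin, nsmul_eq_mul,
        mul_one_div_cancel (by exact_mod_cast hd.ne')])
  have h2 := sum_le_maxShare (r := r) hx.1 hx.2 (I := {i}) (by rw [Finset.card_singleton]; lia)
  rw [Finset.sum_singleton] at h2
  exact Real.rpow_le_rpow (by positivity) (hi.trans h2) hp.le

end

/-! ### The law of the tree process -/

section

variable {d : ℕ} {Ω : Type*} [MeasurableSpace Ω] {P : Measure Ω}
  {T : ℕ → Ω → Finset (List (Fin d))}

namespace IsRandomRecursiveTree

theorem measurableSet_history (hT : IsRandomRecursiveTree d P T) (t : ℕ)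
    (h : ℕ → Finset (List (Fin d))) : MeasurableSet {ω | ∀ s ≤ t, T s ω = h s} := by
  have : {ω | ∀ s ≤ t, T s ω = h s} = ⋂ s, ⋂ (_ : s ≤ t), {ω | T s ω = h s} := by
    ext ω
    simp
  rw [this]
  exact MeasurableSet.iInter fun s => MeasurableSet.iInter fun _ => hT.measurable s _

/-- The transition rule given the whole past has the same probability for every past ending in `V`;
summing over these countably many pasts leaves only the present. -/
theorem measure_step (hT : IsRandomRecursiveTree d P T) (t : ℕ) (V : Finset (List (Fin d)))
    {v : List (Fin d)} (hv : v ∈ treeLeaves V) :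
    P {ω | T t ω = V ∧ T (t + 1) ω = treeGrow V v} =
      P {ω | T t ω = V} / ((treeLeaves V).card : ENNReal) := by
  let H : (Fin t → Finset (List (Fin d))) → ℕ → Finset (List (Fin d)) :=
    fun h s => if hs : s < t then h ⟨s, hs⟩ else V
  have hHt : ∀ h, H h t = V := fun h => by simp [H]
  have hiff : ∀ h ω, (∀ s ≤ t, T s ω = H h s) ↔ (fun s : Fin t => T s ω) = h ∧ T t ω = V := by
    intro h ω
    constructor
    · intro hω
      refine ⟨funext fun s => ?_, hHt h ▸ hω t le_rfl⟩
      simpa [H] using hω s s.2.le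
    · rintro ⟨rfl, hω⟩ s hs
      rcases hs.lt_or_eq with h' | rfl
      · simp [H, h']
      · simpa [H] using hω
  have hdisj : ∀ B : Set Ω, Pairwise (Function.onFun Disjoint fun h =>
      {ω | ∀ s ≤ t, T s ω = H h s} ∩ B) := by
    intro B h h' hne
    refine Set.disjoint_left.2 fun ω hω hω' => hne ?_
    rw [← ((hiff h ω).1 hω.1).1, ← ((hiff h' ω).1 hω'.1).1]
  have hU : ∀ B : Set Ω, {ω | T t ω = V} ∩ B = ⋃ h, {ω | ∀ s ≤ t, T s ω = H h s} ∩ B := by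
    intro B
    ext ω
    simp only [Set.mem_inter_iff, Set.mem_iUnion, Set.mem_ofPred_eq, hiff]
    constructor
    · rintro ⟨hω, hB⟩
      exact ⟨_, ⟨rfl, hω⟩, hB⟩
    · rintro ⟨h, ⟨-, hω⟩, hB⟩
      exact ⟨hω, hB⟩
  have hsum : ∀ B : Set Ω, MeasurableSet B → P ({ω | T t ω = V} ∩ B) =
      ∑' h, P ({ω | ∀ s ≤ t, T s ω = H h s} ∩ B) := by
    intro B hB
    rw [hU, measure_iUnion (hdisj B) fun h => (hT.measurableSet_history t _).inter hB]
  have h1 := hsum {ω | T (t + 1) ω = treeGrow V v} (hT.measurable _ _)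
  have h2 := hsum Set.univ MeasurableSet.univ
  simp only [Set.inter_univ] at h2
  change P ({ω | T t ω = V} ∩ {ω | T (t + 1) ω = treeGrow V v}) = _
  rw [h1, h2, div_eq_mul_inv, ← ENNReal.tsum_mul_right]
  refine tsum_congr fun h => ?_
  have h3 := hT.step t (H h) v (by rwa [hHt])
  rw [hHt] at h3
  exact h3

/-- The disjoint growth events from `V` have total probability `P {T t = V}`, so nothing else
happens except on a null set; there are only countably many `V`. -/
theorem ae_step [IsProbabilityMeasure P] (hT : IsRandomRecursiveTree d P T) (hd : 0 < d) {t : ℕ}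
    (h : ∀ᵐ ω ∂P, IsFullTree (T t ω)) :
    ∀ᵐ ω ∂P, ∃ v ∈ treeLeaves (T t ω), T (t + 1) ω = treeGrow (T t ω) v := by
  have key : ∀ V : Finset (List (Fin d)), IsFullTree V →
      ∀ᵐ ω ∂P, T t ω = V → ∃ v ∈ treeLeaves V, T (t + 1) ω = treeGrow V v := by
    intro V hV
    set E : List (Fin d) → Set Ω := fun v => {ω | T t ω = V ∧ T (t + 1) ω = treeGrow V v}
    have hE : ∀ v, MeasurableSet (E v) := fun v => (hT.measurable _ _).inter (hT.measurable _ _)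
    have hsub : (⋃ v ∈ treeLeaves V, E v) ⊆ {ω | T t ω = V} :=
      Set.iUnion₂_subset fun v _ ω hω => hω.1
    have hN : ((treeLeaves V).card : ENNReal) ≠ 0 := by
      exact_mod_cast (Finset.card_pos.2 (hV.treeLeaves_nonempty hd)).ne'
    have hmeas : P (⋃ v ∈ treeLeaves V, E v) = P {ω | T t ω = V} := by
      rw [measure_biUnion_finset _ fun v _ => hE v,
        Finset.sum_congr rfl fun v hv => hT.measure_step t V hv, Finset.sum_const, nsmul_eq_mul,
        ENNReal.mul_div_cancel hN (by simp)]
      intro v hv w hw hne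
      refine Set.disjoint_left.2 fun ω hω hω' => hne (treeGrow_injOn hd hv hw ?_)
      rw [← hω.2, ← hω'.2]
    have hz : P ({ω | T t ω = V} \ ⋃ v ∈ treeLeaves V, E v) = 0 := by
      rw [measure_sdiff hsub (Finset.measurableSet_biUnion _ fun v _ => hE v).nullMeasurableSet
        (measure_ne_top _ _), hmeas, tsub_self]
    rw [ae_iff]
    refine measure_mono_null (fun ω hω => ?_) hz
    simp only [Set.mem_ofPred_eq, Classical.not_imp, not_exists, not_and] at hω
    refine ⟨hω.1, fun hc => ?_⟩
    obtain ⟨v, hv, hc⟩ := Set.mem_iUnion₂.1 hc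
    exact hω.2 v hv hc.2
  have key' : ∀ᵐ ω ∂P, ∀ V : Finset (List (Fin d)), IsFullTree V →
      T t ω = V → ∃ v ∈ treeLeaves V, T (t + 1) ω = treeGrow V v :=
    ae_all_iff.2 fun V => by
      by_cases hV : IsFullTree V
      · filter_upwards [key V hV] with ω hω _ using hω
      · exact ae_of_all _ fun ω h' => absurd h' hV
  filter_upwards [h, key'] with ω h1 h2 using h2 _ h1 rfl

theorem ae_isFullTree [IsProbabilityMeasure P] (hT : IsRandomRecursiveTree d P T) (hd : 0 < d) :
    ∀ t, ∀ᵐ ω ∂P, IsFullTree (T t ω) ∧ innerCount (T t ω) = t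
  | 0 => by
    filter_upwards [hT.init] with ω hω
    rw [hω]
    exact ⟨isFullTree_singleton, innerCount_singleton⟩
  | t + 1 => by
    have ih := hT.ae_isFullTree hd t
    filter_upwards [ih, hT.ae_step hd (ih.mono fun _ h => h.1)] with ω h1 h2
    obtain ⟨v, hv, h2⟩ := h2
    rw [h2]
    exact ⟨h1.1.grow (treeLeaves_subset hv), by rw [h1.1.innerCount_grow hd hv, h1.2]⟩

theorem ae_monotone [IsProbabilityMeasure P] (hT : IsRandomRecursiveTree d P T) (hd : 0 < d) :
    ∀ᵐ ω ∂P, Monotone fun t => T t ω := by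
  have : ∀ᵐ ω ∂P, ∀ t, ∃ v ∈ treeLeaves (T t ω), T (t + 1) ω = treeGrow (T t ω) v :=
    ae_all_iff.2 fun t => hT.ae_step hd ((hT.ae_isFullTree hd t).mono fun _ h => h.1)
  filter_upwards [this] with ω hω
  refine monotone_nat_of_le_succ fun t => ?_
  obtain ⟨v, -, h⟩ := hω t
  rw [h]
  exact subset_treeGrow

theorem measurable_comp (hT : IsRandomRecursiveTree d P T) (t : ℕ)
    (f : Finset (List (Fin d)) → ENNReal) : Measurable fun ω => f (T t ω) := by
  let _ : MeasurableSpace (Finset (List (Fin d))) := ⊤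
  have h : Measurable (T t) := measurable_to_countable' fun V => hT.measurable t V
  exact measurable_from_top.comp h

theorem lintegral_eq_tsum (hT : IsRandomRecursiveTree d P T) (t : ℕ) (f : Ω → ENNReal) :
    ∫⁻ ω, f ω ∂P = ∑' V, ∫⁻ ω in {ω | T t ω = V}, f ω ∂P := by
  rw [← lintegral_iUnion (fun V => hT.measurable t V), ← setLIntegral_univ]
  · congr 2
    ext ω
    simp
  · intro V W hne
    refine Set.disjoint_left.2 fun ω hω hω' => hne ?_
    exact hω.symm.trans hω'

/-- Condition on the present tree and on the leaf that gives birth. An upper bound suffices for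
Markov's inequality. -/
theorem lintegral_succ_le [IsProbabilityMeasure P] (hT : IsRandomRecursiveTree d P T) (hd : 0 < d)
    (t : ℕ) {F : Finset (List (Fin d)) → ℝ} (hF : ∀ V, 0 ≤ F V) :
    ∫⁻ ω, ENNReal.ofReal (F (T (t + 1) ω)) ∂P ≤ ∫⁻ ω, ENNReal.ofReal (leafAvg F (T t ω)) ∂P := by
  have hstep := hT.ae_step hd ((hT.ae_isFullTree hd t).mono fun _ h => h.1)
  rw [hT.lintegral_eq_tsum t, hT.lintegral_eq_tsum t fun ω => ENNReal.ofReal (leafAvg F (T t ω))]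
  refine ENNReal.tsum_le_tsum fun V => ?_
  set E : List (Fin d) → Set Ω := fun v => {ω | T t ω = V ∧ T (t + 1) ω = treeGrow V v}
  have hE : ∀ v, MeasurableSet (E v) := fun v => (hT.measurable _ _).inter (hT.measurable _ _)
  have h1 : ({ω | T t ω = V} : Set Ω) ≤ᵐ[P] ⋃ v ∈ treeLeaves V, E v := by
    filter_upwards [hstep] with ω hω hV
    have hV' : T t ω = V := hV
    rw [hV'] at hω
    obtain ⟨v, hv, h⟩ := hω
    exact Set.mem_iUnion₂.2 ⟨v, hv, hV', h⟩
  have h2 : ∀ v ∈ treeLeaves V, ∫⁻ ω in E v, ENNReal.ofReal (F (T (t + 1) ω)) ∂P =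
      ENNReal.ofReal (F (treeGrow V v)) *
        (P {ω | T t ω = V} / ((treeLeaves V).card : ENNReal)) := by
    intro v hv
    rw [setLIntegral_congr_fun (g := fun _ => ENNReal.ofReal (F (treeGrow V v))) (hE v)
      fun ω hω => by simp only [hω.2], setLIntegral_const, hT.measure_step t V hv]
  have h3 : ∫⁻ ω in {ω | T t ω = V}, ENNReal.ofReal (leafAvg F (T t ω)) ∂P =
      ENNReal.ofReal (leafAvg F V) * P {ω | T t ω = V} := by
    rw [setLIntegral_congr_fun (g := fun _ => ENNReal.ofReal (leafAvg F V)) (hT.measurable t V)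
      fun ω hω => by
        have : T t ω = V := hω
        simp only [this], setLIntegral_const]
  rw [h3]
  calc ∫⁻ ω in {ω | T t ω = V}, ENNReal.ofReal (F (T (t + 1) ω)) ∂P
      ≤ ∫⁻ ω in ⋃ v ∈ treeLeaves V, E v, ENNReal.ofReal (F (T (t + 1) ω)) ∂P :=
        lintegral_mono_set' h1
    _ ≤ ∑ v ∈ treeLeaves V, ∫⁻ ω in E v, ENNReal.ofReal (F (T (t + 1) ω)) ∂P := by
        rw [lintegral_biUnion_finset _ fun v _ => hE v]
        intro v hv w hw hne
        refine Set.disjoint_left.2 fun ω hω hω' => hne (treeGrow_injOn hd hv hw ?_)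
        rw [← hω.2, ← hω'.2]
    _ = ENNReal.ofReal (∑ v ∈ treeLeaves V, F (treeGrow V v)) *
          (P {ω | T t ω = V} / ((treeLeaves V).card : ENNReal)) := by
        rw [Finset.sum_congr rfl h2, ← Finset.sum_mul,
          ENNReal.ofReal_sum_of_nonneg fun v _ => hF _]
    _ ≤ ENNReal.ofReal (leafAvg F V) * P {ω | T t ω = V} := by
        rcases (treeLeaves V).eq_empty_or_nonempty with h0 | h0
        · simp [h0]
        · have hN : (0 : ℝ) < (treeLeaves V).card := by exact_mod_cast Finset.card_pos.2 h0
          rw [leafAvg, ENNReal.ofReal_div_of_pos hN, ENNReal.ofReal_natCast]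
          simp only [div_eq_mul_inv]
          rw [mul_assoc, mul_comm (P _)]

theorem lintegral_le_iterate_leafAvg [IsProbabilityMeasure P] (hT : IsRandomRecursiveTree d P T)
    (hd : 0 < d) : ∀ (t : ℕ) {F : Finset (List (Fin d)) → ℝ}, (∀ V, 0 ≤ F V) →
    ∫⁻ ω, ENNReal.ofReal (F (T t ω)) ∂P ≤ ENNReal.ofReal (leafAvg^[t] F {[]})
  | 0, F, _ => by
    have : ∫⁻ ω, ENNReal.ofReal (F (T 0 ω)) ∂P = ∫⁻ _, ENNReal.ofReal (F {[]}) ∂P :=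
      lintegral_congr_ae (hT.init.mono fun ω hω => by simp only [hω])
    simp [this]
  | t + 1, F, hF => (hT.lintegral_succ_le hd t hF).trans
      (hT.lintegral_le_iterate_leafAvg hd t fun V =>
        div_nonneg (Finset.sum_nonneg fun v _ => hF _) (Nat.cast_nonneg _))

theorem measure_le [IsProbabilityMeasure P] (hT : IsRandomRecursiveTree d P T)
    (hd : 0 < d) (t : ℕ) {F : Finset (List (Fin d)) → ℝ} (hF : ∀ V, 0 ≤ F V) {c b : ℝ}
    (hc : 0 < c) (hb : leafAvg^[t] F {[]} ≤ b) :
    P {ω | c ≤ F (T t ω)} ≤ ENNReal.ofReal (b / c) := by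
  have h1 := mul_meas_ge_le_lintegral (μ := P)
    (hT.measurable_comp t fun V => ENNReal.ofReal (F V)) (ENNReal.ofReal c)
  have h2 := h1.trans
    ((hT.lintegral_le_iterate_leafAvg hd t hF).trans (ENNReal.ofReal_le_ofReal hb))
  have h3 : {ω | c ≤ F (T t ω)} ⊆ {ω | ENNReal.ofReal c ≤ ENNReal.ofReal (F (T t ω))} :=
    fun ω hω => ENNReal.ofReal_le_ofReal hω
  rw [ENNReal.ofReal_div_of_pos hc, ENNReal.le_div_iff_mul_le (by simp [hc]) (by simp), mul_comm]
  exact le_trans (by gcongr) h2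

end IsRandomRecursiveTree

end

/-! ### Logarithmic time scale and the almost sure bound -/

theorem smallBound_le_of_le {r : ℕ} (hr : 0 < r) (D n : ℕ) {y : ℝ} (hy : (n : ℝ) ≤ y) :
    (smallBound r D n : ℝ) ≤ (D + 1) * ((r : ℝ) ^ n + y) := by
  have hy0 : 0 ≤ y := (Nat.cast_nonneg n).trans hy
  have hD : (0 : ℝ) ≤ D := Nat.cast_nonneg D
  rcases Nat.eq_or_lt_of_le (Nat.succ_le_of_lt hr) with h | h
  · obtain rfl : r = 1 := h.symm
    rw [smallBound_one]
    push_cast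
    rw [one_pow]
    nlinarith
  · have h1 : (smallBound r D n : ℝ) + 1 ≤ (D + 1) * (r : ℝ) ^ n := by
      exact_mod_cast smallBound_add_one_le h D n
    nlinarith

theorem tendsto_floor_log_div {τ : ℝ} (hτ : 1 < τ) :
    Tendsto (fun t : ℕ => ⌊Real.log t / Real.log τ⌋₊) atTop atTop :=
  tendsto_nat_floor_atTop.comp
    ((Real.tendsto_log_atTop.comp tendsto_natCast_atTop_atTop).atTop_div_const (Real.log_pos hτ))

theorem pow_floor_log_div_le {τ t : ℝ} (hτ : 1 < τ) (ht : 1 ≤ t) :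
    τ ^ ⌊Real.log t / Real.log τ⌋₊ ≤ t := by
  have h0 : 0 < Real.log τ := Real.log_pos hτ
  have h := Nat.floor_le (div_nonneg (Real.log_nonneg ht) h0.le)
  rw [le_div_iff₀ h0, ← Real.log_pow] at h
  exact (Real.log_le_log_iff (by positivity) (by linarith)).1 h

theorem le_pow_floor_log_div {τ t : ℝ} (hτ : 1 < τ) (ht : 1 ≤ t) :
    t ≤ τ ^ (⌊Real.log t / Real.log τ⌋₊ + 1) := by
  have h0 : 0 < Real.log τ := Real.log_pos hτ
  have h := (Nat.lt_floor_add_one (Real.log t / Real.log τ)).le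
  rw [div_le_iff₀ h0] at h
  refine (Real.log_le_log_iff (by linarith) (by positivity)).1 ?_
  rw [Real.log_pow]
  exact_mod_cast h

/-- From `τ ^ n ≤ t` the right side is at least `(τ / κ) ^ n`, which outgrows `n`. This absorbs the
linear `smallBound` of the case `r = 1`. -/
theorem eventually_le_mul_inv_pow {τ κ : ℝ} (hκ : 0 < κ) (hκτ : κ < τ) (hτ : 1 < τ) :
    ∀ᶠ t : ℕ in atTop, ((⌊Real.log t / Real.log τ⌋₊ : ℕ) : ℝ) ≤
      t * (κ ^ ⌊Real.log t / Real.log τ⌋₊)⁻¹ := by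
  have h1 : ∀ᶠ n : ℕ in atTop, (n : ℝ) ≤ (τ / κ) ^ n := by
    have hq : 1 < τ / κ := (one_lt_div hκ).2 hκτ
    filter_upwards [(tendsto_pow_const_div_const_pow_of_one_lt 1 hq).eventually_le_const
      one_pos] with n hn
    rw [pow_one, div_le_one (by positivity)] at hn
    exact hn
  filter_upwards [(tendsto_floor_log_div hτ).eventually h1, eventually_ge_atTop 1] with t ht ht1
  refine ht.trans ?_
  rw [div_pow, div_eq_mul_inv]
  gcongr
  exact pow_floor_log_div_le hτ (by exact_mod_cast ht1)

theorem theorem3 (r d : ℕ) (hr : 0 < r) (hrd : r < d) (τ κ lam : ℝ)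
    (hκ : 0 < κ) (hlam : 0 < lam)
    (hτ : Real.exp ((d : ℝ) - 1) < τ)
    (hτ_cond : Real.exp 1 * d * Real.log τ < ((d : ℝ) - 1) * τ ^ (1 / ((d : ℝ) - 1)))
    (hκ_cond : (d : ℝ) * κ ^ lam *
      ∫ x : Fin d → ℝ, (1 - minCoordSum r x) ^ lam
        ∂(dirichletMeasure fun _ : Fin d => 1 / ((d : ℝ) - 1)) < 1) :
    ∃ K : ℝ, ∀ (Ω : Type*) [MeasurableSpace Ω] (P : Measure Ω) [IsProbabilityMeasure P]
      (T : ℕ → Ω → Finset (List (Fin d))), IsRandomRecursiveTree d P T →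
      ∀ᵐ ω ∂P, ∀ᶠ t : ℕ in atTop,
        (largestArySubtree r (T t ω) : ℝ) ≤
          K * ((r : ℝ) ^ ⌊Real.log t / Real.log τ⌋₊ +
            (t : ℝ) * (κ ^ ⌊Real.log t / Real.log τ⌋₊)⁻¹) := by
  have hd : 1 < d := by lia
  have hd0 : 0 < d := by lia
  have hd1 : (1 : ℝ) < d := by exact_mod_cast hd
  have hα : ∀ i : Fin d, 0 < (fun _ : Fin d => 1 / ((d : ℝ) - 1)) i :=
    fun _ => one_div_pos.2 (by linarith)
  have hdτ : (d : ℝ) < τ := by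
    have := Real.add_one_le_exp ((d : ℝ) - 1)
    linarith
  have hτ1 : 1 < τ := hd1.trans hdτ
  set I := ∫ x : Fin d → ℝ, maxShare r x ^ lam
    ∂(dirichletMeasure fun _ : Fin d => 1 / ((d : ℝ) - 1)) with hI
  have hκI : (d : ℝ) * κ ^ lam * I < 1 := hκ_cond
  have hIlow : (1 / (d : ℝ)) ^ lam ≤ I := inv_rpow_le_integral_maxShare hr hd0 hα hlam
  have hκp : 0 < κ ^ lam := Real.rpow_pos_of_pos hκ lam
  have hI0 : 0 ≤ I := (Real.rpow_nonneg (by positivity) _).trans hIlow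
  -- In fact `κ < d`: otherwise `κ ^ lam * I ≥ (κ / d) ^ lam ≥ 1`, contradicting `hκI`.
  have hκτ : κ < τ := by
    refine lt_of_lt_of_le ?_ hdτ.le
    by_contra! hc
    have h1 : 1 ≤ (κ * (1 / (d : ℝ))) ^ lam := by
      refine Real.one_le_rpow ?_ hlam.le
      rw [mul_one_div, one_le_div (by linarith)]
      exact hc
    rw [Real.mul_rpow hκ.le (by positivity)] at h1
    have h2 := mul_le_mul_of_nonneg_left hIlow hκp.le
    nlinarith
  obtain ⟨b, hIb, hb⟩ : ∃ b, I < b ∧ (d : ℝ) * κ ^ lam * b < 1 := by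
    have hc : 0 < (d : ℝ) * κ ^ lam := by positivity
    obtain ⟨b, h1, h2⟩ := exists_between ((lt_div_iff₀' hc).2 hκI)
    exact ⟨b, h1, (lt_div_iff₀' hc).1 h2⟩
  have hb0 : 0 ≤ b := hI0.trans hIb.le
  obtain ⟨N, hN⟩ := exists_polyaMean_rootShare_le hd0 hα hlam hIb
  have hθ : ∀ t, N + 1 ≤ t + 1 → d * polyaMean t (fun _ : Fin d => 1 / ((d : ℝ) - 1))
      (fun m => rootShare r m ^ lam) ≤ d * b := fun t ht => by
    have := hN t (by lia)
    gcongr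
  have hmean := iterate_leafAvg_pathSum_le hd N.succ_pos lam hθ (by positivity)
  set D := d * (N + 1) + 1 with hD
  -- `D + 1` comes from `smallBound`; the other summand is the factor `d + 1` of the deterministic
  -- bound times the loss `s n ≤ 2 * τ * t` from using a later tree.
  refine ⟨(D + 1) + 2 * (d + 1) * τ, fun Ω _ P _ T hT => ?_⟩
  -- All times `t ≥ 1` with the same floor `n` satisfy `t ≤ s n`, so one tree per `n` controls them.
  let s : ℕ → ℕ := fun n => ⌈τ ^ (n + 1)⌉₊
  -- With this threshold Markov's bound is geometric with ratio `d * κ ^ lam * b < 1`, and its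
  -- `lam`-th root is `(κ ^ n)⁻¹`.
  let c : ℕ → ℝ := fun n => ((κ ^ lam) ^ n)⁻¹
  have hc : ∀ n, 0 < c n := fun n => by positivity
  have hbad : ∀ n, P {ω | c n ≤ pathSum r (N + 1) lam n (T (s n) ω)} ≤
      ENNReal.ofReal ((d * κ ^ lam * b) ^ n) := by
    intro n
    refine (hT.measure_le hd0 (s n) (pathSum_nonneg _ _ n) (hc n) (hmean n (s n))).trans_eq ?_
    congr 1
    rw [div_inv_eq_mul, ← mul_pow]
    ring
  have hsum : ∑' n, P {ω | c n ≤ pathSum r (N + 1) lam n (T (s n) ω)} ≠ ⊤ := by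
    have hq : 0 ≤ d * κ ^ lam * b := by positivity
    refine ne_top_of_le_ne_top ?_ (ENNReal.tsum_le_tsum hbad)
    rw [← ENNReal.ofReal_tsum_of_nonneg (fun n => pow_nonneg hq n)
      (summable_geometric_of_lt_one hq hb)]
    exact ENNReal.ofReal_ne_top
  have hfull : ∀ᵐ ω ∂P, ∀ t, IsFullTree (T t ω) ∧ innerCount (T t ω) = t :=
    ae_all_iff.2 (hT.ae_isFullTree hd0)
  filter_upwards [ae_eventually_notMem hsum, hfull, hT.ae_monotone hd0] with ω hω hfullω hmono
  filter_upwards [(tendsto_floor_log_div hτ1).eventually hω,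
    eventually_le_mul_inv_pow hκ hκτ hτ1, eventually_ge_atTop 1] with t hgood hn ht1
  have ht1' : (1 : ℝ) ≤ t := by exact_mod_cast ht1
  have hlow := pow_floor_log_div_le hτ1 ht1'
  have hup := le_pow_floor_log_div hτ1 ht1'
  set n := ⌊Real.log t / Real.log τ⌋₊ with hndef
  have hts : t ≤ s n := by exact_mod_cast hup.trans (Nat.le_ceil _)
  have hst : (s n : ℝ) ≤ 2 * τ * t := by
    have h1 := (Nat.ceil_lt_add_one (by positivity : 0 ≤ τ ^ (n + 1))).le
    have h2 : τ ^ (n + 1) ≤ t * τ := by rw [pow_succ]; gcongr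
    change (⌈τ ^ (n + 1)⌉₊ : ℝ) ≤ _
    nlinarith
  have hpath : pathSum r (N + 1) lam n (T (s n) ω) ^ (1 / lam) ≤ (κ ^ n)⁻¹ := by
    have h1 : pathSum r (N + 1) lam n (T (s n) ω) ≤ ((κ ^ n)⁻¹) ^ lam := by
      have h2 : ((κ ^ n)⁻¹) ^ lam = c n := by
        rw [Real.inv_rpow (by positivity), ← Real.rpow_pow_comm hκ.le]
      rw [h2]
      exact (not_le.1 hgood).le
    refine (Real.rpow_le_rpow (pathSum_nonneg _ _ _ _) h1 (by positivity)).trans_eq ?_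
    rw [← Real.rpow_mul (by positivity), mul_one_div_cancel hlam.ne', Real.rpow_one]
  have hdet := (hfullω (s n)).1.largest_le hr hd hlam N.succ_pos hD.ge n
  rw [(hfullω (s n)).2] at hdet
  have hS : (largestArySubtree r (T t ω) : ℝ) ≤ largestArySubtree r (T (s n) ω) := by
    exact_mod_cast largestArySubtree_mono (hmono hts)
  have hsmall := smallBound_le_of_le hr D n hn
  have hbig : (d + 1) * (s n : ℝ) * pathSum r (N + 1) lam n (T (s n) ω) ^ (1 / lam) ≤
      2 * (d + 1) * τ * ((r : ℝ) ^ n + t * (κ ^ n)⁻¹) := by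
    have h0 := Real.rpow_nonneg (pathSum_nonneg (r := r) (N + 1) lam n (T (s n) ω)) (1 / lam)
    calc (d + 1) * (s n : ℝ) * pathSum r (N + 1) lam n (T (s n) ω) ^ (1 / lam)
        ≤ (d + 1) * (2 * τ * t) * (κ ^ n)⁻¹ := by gcongr
      _ = 2 * (d + 1) * τ * (t * (κ ^ n)⁻¹) := by ring
      _ ≤ 2 * (d + 1) * τ * ((r : ℝ) ^ n + t * (κ ^ n)⁻¹) := by
        gcongr
        exact le_add_of_nonneg_left (by positivity)
  have := hS.trans (hdet.trans (add_le_add hsmall hbig))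
  rwa [← add_mul] at this
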